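/- Let $\mathbf U$ be the quantum group of $\mathfrak{sl}_2$ over $\mathbb Q(q)$, i.e. the $\mathbb Q(q)$-algebra generated by $E,F,K^{\pm1}$ subject to $KK^{-1}=K^{-1}K=1$, $KE=q^2EK$, $KF=q^{-2}FK$, $EF-FE=\frac{K-K^{-1}}{q-q^{-1}}$, with the comultiplication $\Delta:\mathbf U\to\mathbf U\otimes\mathbf U$ given by $\Delta(E)=E\otimes 1+K\otimes E$, $\Delta(F)=1\otimes F+F\otimes K^{-1}$, $\Delta(K)=K\otimes K$. Fix $\boldsymbol\varsigma\in\mathbb Q(q)^\times$ and put $\check E=\boldsymbol\varsigma EK^{-1}$ and $B=F+\boldsymbol\varsigma EK^{-1}$. Write $[n]=\frac{q^n-q^{-n}}{q-q^{-1}}$, $[n]!=[1][2]\cdots[n]$, $x^{(n)}=x^n/[n]!$ for $x\in\{F,\check E\}$ and, for $a\in\mathbb Z$, $n\in\mathbb N$, $$\begin{bmatrix}h;a\\ n\end{bmatrix}=\prod_{i=1}^n\frac{q^{4a+4i-4}K^{-2}-1}{q^{4i}-1}.$$ For $n\in\mathbb N$ define $$B_{\mathrm{odd}}^{(n)}=\frac1{[n]!}\begin{cases}B\prod_{j=1}^k\big(B^2-q\boldsymbol\varsigma[2j-1]^2\big)&\text{if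 }n=2k+1,\\ \prod_{j=1}^k\big(B^2-q\boldsymbol\varsigma[2j-1]^2\big)&\text{if }n=2k.\end{cases}$$ Then, for $n$ even, $$\Delta(B_{\mathrm{odd}}^{(n)})=\sum_{r=0}^nB_{\mathrm{odd}}^{(n-r)}\otimes\bigg(\sum_{c=0}^{\lfloor r/2\rfloor}\sum_{a=0}^{r-2c}(-1)^c q^{c-(r-2c)(r-n)+a(r-2c-a)}(q\boldsymbol\varsigma)^cF^{(a)}\begin{bmatrix}h;1-c+\lfloor\frac{r-1}2\rfloor\\ c\end{bmatrix}K^{r-n}\check E^{(r-2c-a)}\bigg),$$ and, for $n$ odd, $$\Delta(B_{\mathrm{odd}}^{(n)})=\sum_{r=0}^nB_{\mathrm{odd}}^{(n-r)}\otimes\bigg(\sum_{c=0}^{\lfloor r/2\rfloor}\sum_{a=0}^{r-2c}(-1)^c q^{3c-(r-2c)(r-n)+a(r-2c-a)}(q\boldsymbol\varsigma)^cF^{(a)}\begin{bmatrix}h;1-c+\lfloor\frac{r-2}2\rfloor\\ c\end{bmatrix}K^{r-n}\check E^{(r-2c-a)}\bigg).$$ -/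

import Mathlib

open scoped TensorProduct

noncomputable section

namespace IDividedPowers

/-- The base field `ℚ(q)`. -/
abbrev Qq : Type := RatFunc ℚ

/-- The indeterminate `q`. -/
def q : Qq := RatFunc.X

/-- The quantum integer `[n] = (q ^ n - q ^ (-n)) / (q - q⁻¹)`. -/
def qInt (n : ℤ) : Qq := (q ^ n - q ^ (-n)) / (q - q⁻¹)

/-- The quantum factorial `[n]! = [1] [2] ⋯ [n]`. -/
def qFactorial (n : ℕ) : Qq := ∏ i ∈ Finset.Icc 1 n, qInt (i : ℤ)

/-- Names for the generators `E`, `F`, `K`, `K⁻¹`. -/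
inductive Gen : Type
  | E | F | K | Kinv

/-- The free `ℚ(q)`-algebra on the four generators. -/
abbrev Free : Type := FreeAlgebra Qq Gen

/-- The defining relations of the quantum group of `𝔰𝔩₂`. -/
inductive Rel : Free → Free → Prop
  | K_mul_Kinv : Rel (FreeAlgebra.ι Qq Gen.K * FreeAlgebra.ι Qq Gen.Kinv) 1
  | Kinv_mul_K : Rel (FreeAlgebra.ι Qq Gen.Kinv * FreeAlgebra.ι Qq Gen.K) 1
  | K_mul_E : Rel (FreeAlgebra.ι Qq Gen.K * FreeAlgebra.ι Qq Gen.E)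
      (q ^ 2 • (FreeAlgebra.ι Qq Gen.E * FreeAlgebra.ι Qq Gen.K))
  | K_mul_F : Rel (FreeAlgebra.ι Qq Gen.K * FreeAlgebra.ι Qq Gen.F)
      ((q ^ 2)⁻¹ • (FreeAlgebra.ι Qq Gen.F * FreeAlgebra.ι Qq Gen.K))
  | E_F : Rel (FreeAlgebra.ι Qq Gen.E * FreeAlgebra.ι Qq Gen.F
        - FreeAlgebra.ι Qq Gen.F * FreeAlgebra.ι Qq Gen.E)
      ((q - q⁻¹)⁻¹ • (FreeAlgebra.ι Qq Gen.K - FreeAlgebra.ι Qq Gen.Kinv))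

/-- The quantum group `U` of `𝔰𝔩₂` over `ℚ(q)`: generators `E, F, K, K⁻¹`, relations
`K K⁻¹ = K⁻¹ K = 1`, `K E = q² E K`, `K F = q⁻² F K`, `E F - F E = (K - K⁻¹) / (q - q⁻¹)`. -/
def U : Type := RingQuot Rel

instance : Ring U := inferInstanceAs (Ring (RingQuot Rel))

instance : Algebra Qq U := inferInstanceAs (Algebra Qq (RingQuot Rel))

/-- The quotient map from the free algebra. -/
def mk : Free →ₐ[Qq] U := RingQuot.mkAlgHom Qq Rel

/-- The image in `U` of a generator. -/
def gen (g : Gen) : U := mk (FreeAlgebra.ι Qq g)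

/-- The generator `E` of `U`. -/
def E : U := gen Gen.E

/-- The generator `F` of `U`. -/
def F : U := gen Gen.F

theorem mk_rel {x y : Free} (h : Rel x y) : mk x = mk y :=
  RingQuot.mkAlgHom_rel Qq h

theorem gen_K_mul_Kinv : gen Gen.K * gen Gen.Kinv = 1 := by
  simpa [gen] using mk_rel Rel.K_mul_Kinv

theorem gen_Kinv_mul_K : gen Gen.Kinv * gen Gen.K = 1 := by
  simpa [gen] using mk_rel Rel.Kinv_mul_K

/-- The generator `K` of `U`, as a unit, so that `K ^ m` makes sense for every integer `m`. -/
def K : Uˣ where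
  val := gen Gen.K
  inv := gen Gen.Kinv
  val_inv := gen_K_mul_Kinv
  inv_val := gen_Kinv_mul_K

theorem K_mul_E : (K : U) * E = q ^ 2 • (E * (K : U)) := by
  simpa [gen, K, E] using mk_rel Rel.K_mul_E

theorem K_mul_F : (K : U) * F = (q ^ 2)⁻¹ • (F * (K : U)) := by
  simpa [gen, K, F] using mk_rel Rel.K_mul_F

theorem E_mul_F_sub : E * F - F * E = (q - q⁻¹)⁻¹ • ((K : U) - ((K⁻¹ : Uˣ) : U)) := by
  simpa [gen, K, E, F] using mk_rel Rel.E_F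

theorem q_ne_zero : q ≠ 0 := RatFunc.X_ne_zero

theorem Kinv_mul_E : ((K⁻¹ : Uˣ) : U) * E = (q ^ 2)⁻¹ • (E * ((K⁻¹ : Uˣ) : U)) := by
  have h : E * ((K⁻¹ : Uˣ) : U) = q ^ 2 • (((K⁻¹ : Uˣ) : U) * E) := by
    calc E * ((K⁻¹ : Uˣ) : U)
        = ((K⁻¹ : Uˣ) : U) * ((K : U) * E) * ((K⁻¹ : Uˣ) : U) := by
          rw [← mul_assoc, Units.inv_mul, one_mul]
      _ = q ^ 2 • (((K⁻¹ : Uˣ) : U) * E) := by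
          rw [K_mul_E, mul_smul_comm, smul_mul_assoc, mul_assoc, mul_assoc, Units.mul_inv, mul_one]
  rw [h, smul_smul, inv_mul_cancel₀ (pow_ne_zero 2 q_ne_zero), one_smul]

theorem F_mul_Kinv : F * ((K⁻¹ : Uˣ) : U) = (q ^ 2)⁻¹ • (((K⁻¹ : Uˣ) : U) * F) := by
  calc F * ((K⁻¹ : Uˣ) : U)
      = ((K⁻¹ : Uˣ) : U) * ((K : U) * F) * ((K⁻¹ : Uˣ) : U) := by
        rw [← mul_assoc, Units.inv_mul, one_mul]
    _ = (q ^ 2)⁻¹ • (((K⁻¹ : Uˣ) : U) * F) := by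
        rw [K_mul_F, mul_smul_comm, smul_mul_assoc, mul_assoc, mul_assoc, Units.mul_inv, mul_one]

/-- The values of the comultiplication on the generators:
`E ↦ E ⊗ 1 + K ⊗ E`, `F ↦ 1 ⊗ F + F ⊗ K⁻¹`, `K ↦ K ⊗ K`, `K⁻¹ ↦ K⁻¹ ⊗ K⁻¹`. -/
def comulGen : Gen → U ⊗[Qq] U
  | Gen.E => E ⊗ₜ[Qq] (1 : U) + (K : U) ⊗ₜ[Qq] E
  | Gen.F => (1 : U) ⊗ₜ[Qq] F + F ⊗ₜ[Qq] ((K⁻¹ : Uˣ) : U)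
  | Gen.K => (K : U) ⊗ₜ[Qq] (K : U)
  | Gen.Kinv => ((K⁻¹ : Uˣ) : U) ⊗ₜ[Qq] ((K⁻¹ : Uˣ) : U)

theorem comulGen_rel {x y : Free} (h : Rel x y) :
    FreeAlgebra.lift Qq comulGen x = FreeAlgebra.lift Qq comulGen y := by
  have h2 : q ^ 2 ≠ 0 := pow_ne_zero 2 q_ne_zero
  cases h with
  | K_mul_Kinv =>
    simp [comulGen, Algebra.TensorProduct.one_def]
  | Kinv_mul_K =>
    simp [comulGen, Algebra.TensorProduct.one_def]
  | K_mul_E =>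
    simp only [map_mul, map_smul, FreeAlgebra.lift_ι_apply, comulGen, mul_add, add_mul,
      Algebra.TensorProduct.tmul_mul_tmul, mul_one, one_mul, K_mul_E, smul_add,
      TensorProduct.tmul_smul, TensorProduct.smul_tmul']
  | K_mul_F =>
    simp only [map_mul, map_smul, FreeAlgebra.lift_ι_apply, comulGen, mul_add, add_mul,
      Algebra.TensorProduct.tmul_mul_tmul, mul_one, one_mul, K_mul_F, smul_add,
      TensorProduct.tmul_smul, TensorProduct.smul_tmul', Units.mul_inv, Units.inv_mul]
  | E_F =>
    have hEF : E * F = F * E + (q - q⁻¹)⁻¹ • ((K : U) - ((K⁻¹ : Uˣ) : U)) := by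
      rw [← E_mul_F_sub]; abel
    have hx : ((K : U) * F) ⊗ₜ[Qq] (E * ((K⁻¹ : Uˣ) : U))
        = (F * (K : U)) ⊗ₜ[Qq] (((K⁻¹ : Uˣ) : U) * E) := by
      rw [K_mul_F, Kinv_mul_E, TensorProduct.tmul_smul, TensorProduct.smul_tmul']
    simp only [map_mul, map_sub, map_smul, FreeAlgebra.lift_ι_apply, comulGen, mul_add, add_mul,
      Algebra.TensorProduct.tmul_mul_tmul, mul_one, one_mul, hx, hEF,
      TensorProduct.add_tmul, TensorProduct.tmul_add, TensorProduct.sub_tmul,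
      TensorProduct.tmul_sub, ← TensorProduct.smul_tmul', TensorProduct.tmul_smul, smul_sub]
    abel

/-- The comultiplication `Δ : U → U ⊗ U`, the algebra homomorphism with
`Δ(E) = E ⊗ 1 + K ⊗ E`, `Δ(F) = 1 ⊗ F + F ⊗ K⁻¹`, `Δ(K) = K ⊗ K`. -/
def Δ : U →ₐ[Qq] U ⊗[Qq] U :=
  RingQuot.liftAlgHom Qq
    ⟨FreeAlgebra.lift Qq comulGen, fun _ _ h => comulGen_rel h⟩

theorem Δ_gen (g : Gen) : Δ (gen g) = comulGen g := by
  have h : Δ (mk (FreeAlgebra.ι Qq g)) = FreeAlgebra.lift Qq comulGen (FreeAlgebra.ι Qq g) :=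
    RingQuot.liftAlgHom_mkAlgHom_apply Qq _ _ _
  rw [FreeAlgebra.lift_ι_apply] at h
  exact h

theorem Δ_E : Δ E = E ⊗ₜ[Qq] (1 : U) + (K : U) ⊗ₜ[Qq] E := Δ_gen Gen.E

theorem Δ_F : Δ F = (1 : U) ⊗ₜ[Qq] F + F ⊗ₜ[Qq] ((K⁻¹ : Uˣ) : U) := Δ_gen Gen.F

theorem Δ_K : Δ (K : U) = (K : U) ⊗ₜ[Qq] (K : U) := Δ_gen Gen.K

/-- The divided power `x ^ (n) = x ^ n / [n]!`. -/
def divPow (x : U) (n : ℕ) : U := (qFactorial n)⁻¹ • x ^ n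

/-- `Ě = ς E K⁻¹`. -/
def Echeck (ς : Qq) : U := ς • (E * ((K⁻¹ : Uˣ) : U))

/-- `B = F + ς E K⁻¹`. -/
def B (ς : Qq) : U := F + Echeck ς

/-- The `ı`-divided power `B_odd ^ (n)`: for `n = 2k + 1` it is
`B ∏_{j=1}^k (B² - qς[2j-1]²) / [n]!`, for `n = 2k` it is `∏_{j=1}^k (B² - qς[2j-1]²) / [n]!`.
The product over `j = 1, …, k` is indexed below by `i = j - 1`, so that `2j - 1 = 2i + 1`. -/
def BOdd (ς : Qq) (n : ℕ) : U :=
  (qFactorial n)⁻¹ •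
    ((if Odd n then B ς else 1) *
      ((List.range (n / 2)).map fun i =>
        B ς ^ 2 - algebraMap Qq U (q * ς * qInt (2 * (i : ℤ) + 1) ^ 2)).prod)

/-- `[h; a, n] = ∏_{i=1}^n (q^(4a+4i-4) K⁻² - 1) / (q^(4i) - 1)`, for `a ∈ ℤ` and `n ∈ ℕ`.
The product is indexed below by `j = i - 1`. -/
def hBinom (a : ℤ) (n : ℕ) : U :=
  ((List.range n).map fun j =>
    (q ^ (4 * (j + 1)) - 1)⁻¹ •
      (q ^ (4 * a + 4 * (j : ℤ)) • ((K ^ (-2 : ℤ) : Uˣ) : U) - 1)).prod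

end IDividedPowers

end

noncomputable section

namespace IDividedPowers

open Polynomial

/-! Two facts drive an induction on `n`. First, `Δ B = B ⊗ K⁻¹ + 1 ⊗ B` (`Δ_B`). Second, `B * BOdd n
= [n+1] BOdd (n+1) + qς[n] BOdd (n-1)`, where the last term occurs only for odd `n` (`B_mul_BOdd`).
Hence `[n+1] Δ(BOdd (n+1))` is determined by the two previous coproducts. Writing `R(n, r)` for the
right factor paired with `BOdd (n-r)`, it suffices that (`rightFactor_recursion`) `[n+1] R(n+1, r) =
[n+1-r] K⁻¹ R(n, r) + B R(n, r-1) + qς[n-r+2] K⁻¹ R(n, r-2) - qς[n] R(n-1, r-2)`, the third term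
present only for `n - r` odd, the fourth only for `n` odd.

Each `R(n, r)` is a sum of elements `F^(a) P(K⁻²) K^(r-n) Ě^(m)`, and left multiplication by `K⁻¹`,
`F`, `Ě` acts explicitly on the polynomials `P`. Matching these polynomials is enough, so linear
independence of the monomials plays no role. They are compared at every value `y` of `K⁻²`
(`coef_recursion`). Nonzero coefficients have `r = a + m + 2c`. For `c = k + 1` every term contains
one common product of `k` factors, and what remains is a rational identity in `q, q^a, q^m, q^k,
q^n, y`, one for each parity of `n` and `r`; `c = 0` gives one more. -/

/-! ### Quantum integers and factorials. -/

theorem q_pow_ne_one {k : ℕ} (hk : k ≠ 0) : q ^ k ≠ 1 := by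
  intro h
  have h1 : algebraMap ℚ[X] Qq (X ^ k) = algebraMap ℚ[X] Qq 1 := by
    rw [map_pow, RatFunc.algebraMap_X, map_one]
    exact h
  have h2 := congrArg natDegree (RatFunc.algebraMap_injective ℚ h1)
  simp at h2
  exact hk h2

theorem q_sub_inv_ne_zero : q - q⁻¹ ≠ 0 := by
  intro h
  have h1 : q ^ 2 = 1 := by
    rw [sub_eq_zero] at h
    calc q ^ 2 = q * q := sq q
      _ = q * q⁻¹ := by rw [← h]
      _ = 1 := mul_inv_cancel₀ q_ne_zero
  exact q_pow_ne_one two_ne_zero h1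

theorem q_sq_sub_one_ne_zero : q ^ 2 - 1 ≠ 0 :=
  sub_ne_zero.2 (q_pow_ne_one two_ne_zero)

theorem q_zpow_two_mul (a : ℤ) : q ^ (2 * a) = (q ^ a) ^ 2 := by
  rw [mul_comm, zpow_mul]
  norm_cast

theorem q_zpow_four_mul (a : ℤ) : q ^ (4 * a) = (q ^ a) ^ 4 := by
  rw [mul_comm, zpow_mul]
  norm_cast

theorem qInt_zero : qInt 0 = 0 := by simp [qInt]

theorem qInt_one : qInt 1 = 1 := by
  simp [qInt, div_self q_sub_inv_ne_zero]

theorem qInt_succ_ne_zero (k : ℕ) : qInt ((k : ℤ) + 1) ≠ 0 := by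
  have hq := q_ne_zero
  intro h
  rw [qInt, div_eq_zero_iff, or_iff_left q_sub_inv_ne_zero, sub_eq_zero, zpow_neg] at h
  have h1 : q ^ (2 * (k + 1)) = 1 := by
    have h2 : q ^ ((k : ℤ) + 1) * q ^ ((k : ℤ) + 1) = 1 := by
      nth_rewrite 1 [h]
      exact inv_mul_cancel₀ (zpow_ne_zero _ hq)
    rw [← zpow_add₀ hq] at h2
    rw [← h2, ← zpow_natCast]
    congr 1
    push_cast
    ring
  exact q_pow_ne_one (by omega) h1

theorem qFactorial_succ (k : ℕ) : qFactorial (k + 1) = qFactorial k * qInt ((k : ℤ) + 1) := by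
  rw [qFactorial, Finset.prod_Icc_succ_top (by omega)]
  simp [qFactorial]

theorem qFactorial_ne_zero (k : ℕ) : qFactorial k ≠ 0 := by
  induction k with
  | zero => simp [qFactorial]
  | succ k ih => rw [qFactorial_succ]; exact mul_ne_zero ih (qInt_succ_ne_zero k)

theorem divPow_zero (x : U) : divPow x 0 = 1 := by simp [divPow, qFactorial]

theorem mul_divPow (x : U) (k : ℕ) : x * divPow x k = qInt ((k : ℤ) + 1) • divPow x (k + 1) := by
  have h := qFactorial_ne_zero k
  have h' := qInt_succ_ne_zero k
  rw [divPow, divPow, mul_smul_comm, ← pow_succ', smul_smul, qFactorial_succ]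
  congr 1
  field_simp

/-! ### Commutation relations among `F`, `Ě` and powers of `K`. -/

/-- The inverse square `K⁻²`. -/
def Kinvsq : U := ((K ^ (-2 : ℤ) : Uˣ) : U)

theorem Kinv_mul_F : ((K⁻¹ : Uˣ) : U) * F = q ^ 2 • (F * ((K⁻¹ : Uˣ) : U)) := by
  rw [F_mul_Kinv, smul_smul, mul_inv_cancel₀ (pow_ne_zero 2 q_ne_zero), one_smul]

theorem Kinv_mul_Kinv : ((K⁻¹ : Uˣ) : U) * ((K⁻¹ : Uˣ) : U) = Kinvsq := by
  rw [Kinvsq, ← Units.val_mul, ← zpow_neg_one, ← zpow_add]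
  norm_num

theorem E_mul_Kinv : E * ((K⁻¹ : Uˣ) : U) = q ^ 2 • (((K⁻¹ : Uˣ) : U) * E) := by
  rw [Kinv_mul_E, smul_smul, mul_inv_cancel₀ (pow_ne_zero 2 q_ne_zero), one_smul]

theorem Echeck_mul_Kinv (ς : Qq) :
    Echeck ς * ((K⁻¹ : Uˣ) : U) = q ^ 2 • (((K⁻¹ : Uˣ) : U) * Echeck ς) := by
  rw [Echeck, smul_mul_assoc, mul_smul_comm, smul_comm]
  nth_rewrite 1 [E_mul_Kinv]
  rw [smul_mul_assoc, mul_assoc]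

theorem Echeck_mul_Kinvsq (ς : Qq) : Echeck ς * Kinvsq = q ^ 4 • (Kinvsq * Echeck ς) := by
  rw [← Kinv_mul_Kinv, ← mul_assoc, Echeck_mul_Kinv, smul_mul_assoc, mul_assoc, Echeck_mul_Kinv,
    mul_smul_comm, smul_smul, mul_assoc]
  congr 1
  ring

theorem K_mul_Echeck (ς : Qq) : (K : U) * Echeck ς = q ^ 2 • (Echeck ς * (K : U)) := by
  rw [Echeck, mul_smul_comm, smul_mul_assoc, ← mul_assoc, K_mul_E, smul_comm, smul_mul_assoc,
    mul_assoc, mul_assoc, Units.mul_inv, Units.inv_mul]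

theorem Echeck_mul_K_zpow (ς : Qq) (s : ℤ) :
    Echeck ς * ((K ^ s : Uˣ) : U) = q ^ (-2 * s) • (((K ^ s : Uˣ) : U) * Echeck ς) := by
  have hq := q_ne_zero
  have hK : Echeck ς * (K : U) = q ^ (-2 : ℤ) • ((K : U) * Echeck ς) := by
    rw [K_mul_Echeck, smul_smul, zpow_neg]
    norm_cast
    rw [inv_mul_cancel₀ (pow_ne_zero 2 hq), one_smul]
  induction s using Int.induction_on with
  | zero => simp
  | succ i ih =>
    rw [zpow_add_one, Units.val_mul, ← mul_assoc, ih, smul_mul_assoc, mul_assoc, hK,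
      mul_smul_comm, smul_smul, mul_assoc, ← zpow_add₀ hq]
    congr 2
    ring
  | pred i ih =>
    rw [zpow_sub_one, Units.val_mul, ← mul_assoc, ih, smul_mul_assoc, mul_assoc, Echeck_mul_Kinv,
      mul_smul_comm, smul_smul, mul_assoc, ← zpow_natCast, ← zpow_add₀ hq]
    congr 2
    push_cast
    ring

theorem Echeck_mul_F (ς : Qq) :
    Echeck ς * F = q ^ 2 • (F * Echeck ς) + (ς * q ^ 2 * (q - q⁻¹)⁻¹) • (1 - Kinvsq) := by
  have hEF : E * F = F * E + (q - q⁻¹)⁻¹ • ((K : U) - ((K⁻¹ : Uˣ) : U)) := by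
    rw [← E_mul_F_sub]; abel
  rw [Echeck, smul_mul_assoc, mul_assoc, Kinv_mul_F, mul_smul_comm, ← mul_assoc, hEF, add_mul,
    smul_mul_assoc, sub_mul, Units.mul_inv, Kinv_mul_Kinv, mul_smul_comm, smul_add, smul_add,
    smul_smul, smul_smul, smul_smul, smul_smul, mul_assoc]
  congr 2
  ring

theorem Kinv_mul_divPow_F (a : ℕ) :
    ((K⁻¹ : Uˣ) : U) * divPow F a = q ^ (2 * (a : ℤ)) • (divPow F a * ((K⁻¹ : Uˣ) : U)) := by
  have hq := q_ne_zero
  have h : ((K⁻¹ : Uˣ) : U) * F ^ a = q ^ (2 * a) • (F ^ a * ((K⁻¹ : Uˣ) : U)) := by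
    induction a with
    | zero => simp
    | succ a ih =>
      rw [pow_succ, ← mul_assoc, ih, smul_mul_assoc, mul_assoc, Kinv_mul_F, mul_smul_comm,
        smul_smul, mul_assoc]
      congr 1
      ring
  rw [divPow, mul_smul_comm, h, smul_mul_assoc, smul_comm]
  norm_cast

theorem Kinvsq_mul_divPow_F (a : ℕ) :
    Kinvsq * divPow F a = q ^ (4 * (a : ℤ)) • (divPow F a * Kinvsq) := by
  rw [← Kinv_mul_Kinv, mul_assoc, Kinv_mul_divPow_F, mul_smul_comm, ← mul_assoc,
    Kinv_mul_divPow_F, smul_mul_assoc, smul_smul, mul_assoc, ← zpow_add₀ q_ne_zero]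
  congr 2
  ring

/-- Induction on `a`: multiplying by the nonzero `[a+2]` splits one `F` off the left, `Ě` passes it
by `Echeck_mul_F`, and the `K⁻²` created there is moved to the right of `F^(a+1)`. -/
theorem Echeck_mul_divPow_F (ς : Qq) (a : ℕ) :
    Echeck ς * divPow F (a + 1) = q ^ (2 * (a : ℤ) + 2) • (divPow F (a + 1) * Echeck ς) +
      (ς * q ^ (2 * (a : ℤ) + 2) * (q - q⁻¹)⁻¹) •
        (divPow F a * (q ^ (-(a : ℤ)) • 1 - q ^ (a : ℤ) • Kinvsq)) := by
  have hq := q_ne_zero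
  have hd := q_sq_sub_one_ne_zero
  have h0 : divPow F 1 = F := by
    have := mul_divPow F 0
    simpa [divPow_zero, qInt_one] using this.symm
  induction a with
  | zero =>
    rw [h0, Echeck_mul_F]
    simp [divPow_zero]
  | succ a ih =>
    have hne := qInt_succ_ne_zero (a + 1)
    have h1 := mul_divPow F (a + 1)
    have h2 := mul_divPow F a
    refine smul_right_injective U hne ?_
    dsimp only
    have e1 : qInt (((a + 1 : ℕ) : ℤ) + 1) • (Echeck ς * divPow F (a + 1 + 1)) =
        Echeck ς * F * divPow F (a + 1) := by
      rw [mul_assoc, h1, mul_smul_comm]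
    have e2 : qInt (((a + 1 : ℕ) : ℤ) + 1) • (divPow F (a + 1 + 1) * Echeck ς) =
        F * divPow F (a + 1) * Echeck ς := by
      rw [h1, smul_mul_assoc]
    rw [e1, smul_add, smul_comm _ _ (divPow F (a + 1 + 1) * Echeck ς), e2, Echeck_mul_F, add_mul,
      smul_mul_assoc, smul_mul_assoc, mul_assoc, ih, sub_mul, one_mul, Kinvsq_mul_divPow_F]
    simp only [mul_add, mul_sub, mul_smul_comm, mul_one, ← mul_assoc, h2, smul_mul_assoc,
      smul_add, smul_sub, smul_smul]
    have hA : q ^ (a : ℤ) ≠ 0 := zpow_ne_zero _ hq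
    -- Only three words occur, `F^(a+2) Ě`, `F^(a+1)` and `F^(a+1) K⁻²`; their scalars are matched
    -- separately.
    have r1 : ∀ (x y z : U) (c1 c2 c3 c4 c5 d1 d2 d3: Qq), c1 = d1 → c2 + c4 = d2 → c3 + c5 = d3 →
        c1 • x + (c2 • y - c3 • z) + (c4 • y - c5 • z) = d1 • x + (d2 • y - d3 • z) := by
      rintro x y z c1 c2 c3 c4 c5 d1 d2 d3 rfl rfl rfl
      simp only [add_smul]
      abel
    refine r1 _ _ _ _ _ _ _ _ _ _ _ ?_ ?_ ?_
    all_goals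
      simp only [qInt, Nat.cast_add, Nat.cast_one, mul_add, neg_add, zpow_add₀ hq, zpow_neg,
        mul_one, q_zpow_two_mul, q_zpow_four_mul, zpow_ofNat]
      generalize q ^ (a : ℤ) = A at *
      field_simp
      try ring

/-! ### Left multiplication on sums of ordered monomials. -/

/-- The element `F^(a) P(K⁻²) K^s Ě^(m)`. -/
def monomialPBW (ς : Qq) (s : ℤ) (a m : ℕ) (P : Qq[X]) : U :=
  divPow F a * aeval Kinvsq P * ((K ^ s : Uˣ) : U) * divPow (Echeck ς) m

theorem monomialPBW_add (ς : Qq) (s : ℤ) (a m : ℕ) (P P' : Qq[X]) :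
    monomialPBW ς s a m (P + P') = monomialPBW ς s a m P + monomialPBW ς s a m P' := by
  simp [monomialPBW, mul_add, add_mul]

theorem monomialPBW_smul (ς : Qq) (s : ℤ) (a m : ℕ) (c : Qq) (P : Qq[X]) :
    monomialPBW ς s a m (c • P) = c • monomialPBW ς s a m P := by
  simp [monomialPBW]

theorem monomialPBW_zero (ς : Qq) (s : ℤ) (a m : ℕ) : monomialPBW ς s a m 0 = 0 := by
  simp [monomialPBW]

/-- Both factors are values at `K⁻¹` of polynomials, and those commute. -/
theorem Kinv_mul_aeval (P : Qq[X]) :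
    ((K⁻¹ : Uˣ) : U) * aeval Kinvsq P = aeval Kinvsq P * ((K⁻¹ : Uˣ) : U) := by
  have h : Kinvsq = aeval ((K⁻¹ : Uˣ) : U) (X ^ 2 : Qq[X]) := by
    rw [map_pow, aeval_X, sq, Kinv_mul_Kinv]
  calc ((K⁻¹ : Uˣ) : U) * aeval Kinvsq P
      = aeval ((K⁻¹ : Uˣ) : U) (X : Qq[X]) * aeval Kinvsq P := by rw [aeval_X]
    _ = aeval Kinvsq P * aeval ((K⁻¹ : Uˣ) : U) (X : Qq[X]) := by
        rw [h, ← aeval_comp, ← map_mul, ← map_mul, mul_comm]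
    _ = aeval Kinvsq P * ((K⁻¹ : Uˣ) : U) := by rw [aeval_X]

theorem Echeck_mul_aeval (ς : Qq) (P : Qq[X]) :
    Echeck ς * aeval Kinvsq P = aeval Kinvsq (P.comp (C (q ^ 4) * X)) * Echeck ς := by
  induction P using Polynomial.induction_on' with
  | add p r hp hr => simp only [map_add, mul_add, hp, hr, add_comp, add_mul]
  | monomial n c =>
    have h : Echeck ς * Kinvsq ^ n = (q ^ 4) ^ n • (Kinvsq ^ n * Echeck ς) := by
      induction n with
      | zero => simp
      | succ n ih =>
        rw [pow_succ, ← mul_assoc, ih, smul_mul_assoc, mul_assoc, Echeck_mul_Kinvsq,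
          mul_smul_comm, smul_smul, mul_assoc, ← pow_succ]
    rw [← C_mul_X_pow_eq_monomial, ← smul_eq_C_mul, map_smul, map_pow, aeval_X, mul_smul_comm, h,
      smul_comp, map_smul, X_pow_comp, mul_pow, ← C_pow, ← smul_eq_C_mul, map_smul, map_pow,
      aeval_X, smul_mul_assoc, smul_mul_assoc]

theorem Kinv_mul_monomialPBW (ς : Qq) (s : ℤ) (a m : ℕ) (P : Qq[X]) :
    ((K⁻¹ : Uˣ) : U) * monomialPBW ς s a m P =
      monomialPBW ς (s - 1) a m (q ^ (2 * (a : ℤ)) • P) := by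
  have hK : ((K⁻¹ : Uˣ) : U) * ((K ^ s : Uˣ) : U) = ((K ^ (s - 1) : Uˣ) : U) := by
    rw [← Units.val_mul, ← zpow_neg_one, ← zpow_add]
    congr 2
    ring
  rw [monomialPBW_smul, monomialPBW, monomialPBW, ← mul_assoc, ← mul_assoc, ← mul_assoc,
    Kinv_mul_divPow_F, smul_mul_assoc, mul_assoc (divPow F a), Kinv_mul_aeval, ← hK]
  simp only [smul_mul_assoc, mul_assoc]

/-- A shift of the `K`-exponent by two is absorbed into the polynomial, which brings the `R(n, r-2)`
term of the recursion to the same power of `K` as the others. -/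
theorem monomialPBW_sub_two (ς : Qq) (s : ℤ) (a m : ℕ) (P : Qq[X]) :
    monomialPBW ς (s - 2) a m P = monomialPBW ς s a m (X * P) := by
  have hK : Kinvsq * ((K ^ s : Uˣ) : U) = ((K ^ (s - 2) : Uˣ) : U) := by
    rw [Kinvsq, ← Units.val_mul, ← zpow_add]
    congr 2
    ring
  rw [monomialPBW, monomialPBW, mul_comm X P, map_mul, aeval_X, ← hK]
  simp only [mul_assoc]

theorem F_mul_monomialPBW (ς : Qq) (s : ℤ) (a m : ℕ) (P : Qq[X]) :
    F * monomialPBW ς s a m P = monomialPBW ς s (a + 1) m (qInt ((a : ℤ) + 1) • P) := by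
  rw [monomialPBW_smul, monomialPBW, monomialPBW, ← mul_assoc, ← mul_assoc, ← mul_assoc,
    mul_divPow]
  simp only [smul_mul_assoc]

theorem aeval_mul_Echeck_tail (ς : Qq) (s : ℤ) (m : ℕ) (P : Qq[X]) :
    Echeck ς * (aeval Kinvsq P * ((K ^ s : Uˣ) : U) * divPow (Echeck ς) m) =
      (q ^ (-2 * s) * qInt ((m : ℤ) + 1)) •
        (aeval Kinvsq (P.comp (C (q ^ 4) * X)) * ((K ^ s : Uˣ) : U) *
          divPow (Echeck ς) (m + 1)) := by
  rw [← mul_assoc, ← mul_assoc, Echeck_mul_aeval, mul_assoc (aeval Kinvsq _), Echeck_mul_K_zpow,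
    mul_smul_comm, smul_mul_assoc, ← mul_assoc, mul_assoc _ (Echeck ς), mul_divPow, mul_smul_comm,
    smul_smul]

/-- The lowering polynomial `ς q^(2a+2) (q^(-a) - q^a X) / (q - q⁻¹)`. -/
def lowerPoly (ς : Qq) (a : ℕ) : Qq[X] :=
  (ς * q ^ (2 * (a : ℤ) + 2) * (q - q⁻¹)⁻¹) • (C (q ^ (-(a : ℤ))) - C (q ^ (a : ℤ)) * X)

theorem Echeck_mul_monomialPBW_zero (ς : Qq) (s : ℤ) (m : ℕ) (P : Qq[X]) :
    Echeck ς * monomialPBW ς s 0 m P =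
      monomialPBW ς s 0 (m + 1)
        ((q ^ (2 * ((0 : ℕ) : ℤ) - 2 * s) * qInt ((m : ℤ) + 1)) • P.comp (C (q ^ 4) * X)) := by
  rw [monomialPBW_smul, monomialPBW, monomialPBW, divPow_zero, one_mul, one_mul,
    aeval_mul_Echeck_tail]
  congr 3
  push_cast
  ring

/-- `Ě` either passes all of `F^(a+1)` and joins the powers of `Ě` on the right, or is used up
against one `F`, leaving `lowerPoly`. -/
theorem Echeck_mul_monomialPBW_succ (ς : Qq) (s : ℤ) (a m : ℕ) (P : Qq[X]) :
    Echeck ς * monomialPBW ς s (a + 1) m P =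
      monomialPBW ς s (a + 1) (m + 1)
        ((q ^ (2 * ((a + 1 : ℕ) : ℤ) - 2 * s) * qInt ((m : ℤ) + 1)) • P.comp (C (q ^ 4) * X)) +
      monomialPBW ς s a m (lowerPoly ς a * P) := by
  have h1 : Echeck ς * monomialPBW ς s (a + 1) m P = Echeck ς * divPow F (a + 1) *
      (aeval Kinvsq P * ((K ^ s : Uˣ) : U) * divPow (Echeck ς) m) := by
    simp only [monomialPBW, mul_assoc]
  rw [h1, Echeck_mul_divPow_F, add_mul]
  congr 1
  · rw [smul_mul_assoc, mul_assoc, aeval_mul_Echeck_tail, mul_smul_comm, smul_smul,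
      monomialPBW_smul, ← mul_assoc, ← zpow_add₀ q_ne_zero, monomialPBW]
    simp only [mul_assoc]
    congr 3
    push_cast
    ring
  · have h2 : (ς * q ^ (2 * (a : ℤ) + 2) * (q - q⁻¹)⁻¹) •
        (q ^ (-(a : ℤ)) • (1 : U) - q ^ (a : ℤ) • Kinvsq) = aeval Kinvsq (lowerPoly ς a) := by
      rw [lowerPoly, map_smul]
      simp only [map_sub, map_mul, aeval_X, aeval_C, Algebra.smul_def, mul_one]
    rw [← mul_smul_comm, h2, monomialPBW, map_mul]
    simp only [mul_assoc]

/-- The sum of the elements `F^(a) G(a, m)(K⁻²) K^s Ě^(m)` over `a, m < N`. -/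
def sumPBW (ς : Qq) (s : ℤ) (N : ℕ) (G : ℕ → ℕ → Qq[X]) : U :=
  ∑ a ∈ Finset.range N, ∑ m ∈ Finset.range N, monomialPBW ς s a m (G a m)

theorem sumPBW_congr {ς : Qq} {s : ℤ} {N : ℕ} {G G' : ℕ → ℕ → Qq[X]}
    (h : ∀ a m, G a m = G' a m) : sumPBW ς s N G = sumPBW ς s N G' := by
  simp only [sumPBW, h]

theorem sumPBW_add (ς : Qq) (s : ℤ) (N : ℕ) (G G' : ℕ → ℕ → Qq[X]) :
    sumPBW ς s N G + sumPBW ς s N G' = sumPBW ς s N (fun a m => G a m + G' a m) := by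
  simp only [sumPBW, monomialPBW_add, Finset.sum_add_distrib]

theorem sumPBW_sub (ς : Qq) (s : ℤ) (N : ℕ) (G G' : ℕ → ℕ → Qq[X]) :
    sumPBW ς s N G - sumPBW ς s N G' = sumPBW ς s N (fun a m => G a m - G' a m) := by
  rw [sub_eq_iff_eq_add, sumPBW_add]
  simp only [sub_add_cancel]

theorem smul_sumPBW (ς : Qq) (s : ℤ) (N : ℕ) (c : Qq) (G : ℕ → ℕ → Qq[X]) :
    c • sumPBW ς s N G = sumPBW ς s N (fun a m => c • G a m) := by
  simp only [sumPBW, monomialPBW_smul, Finset.smul_sum]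

theorem sumPBW_sub_two (ς : Qq) (s : ℤ) (N : ℕ) (G : ℕ → ℕ → Qq[X]) :
    sumPBW ς (s - 2) N G = sumPBW ς s N (fun a m => X * G a m) := by
  simp only [sumPBW, monomialPBW_sub_two]

theorem Kinv_mul_sumPBW (ς : Qq) (s : ℤ) (N : ℕ) (G : ℕ → ℕ → Qq[X]) :
    ((K⁻¹ : Uˣ) : U) * sumPBW ς s N G =
      sumPBW ς (s - 1) N (fun a m => q ^ (2 * (a : ℤ)) • G a m) := by
  simp only [sumPBW, Finset.mul_sum, Kinv_mul_monomialPBW]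

/-- The support condition keeps the raised monomials inside the index box. The truncated `a - 1` is
harmless because `[0] = 0`. -/
theorem F_mul_sumPBW (ς : Qq) (s : ℤ) (N : ℕ) (G : ℕ → ℕ → Qq[X])
    (hG : ∀ a m, N ≤ a → G a m = 0) :
    F * sumPBW ς s (N + 1) G = sumPBW ς s (N + 1) (fun a m => qInt a • G (a - 1) m) := by
  rw [sumPBW, sumPBW, Finset.sum_range_succ,
    Finset.sum_range_succ' (fun a => ∑ m ∈ Finset.range (N + 1), _) N]
  simp [hG, monomialPBW_zero, qInt_zero, Finset.mul_sum, F_mul_monomialPBW]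

theorem Echeck_mul_sumPBW (ς : Qq) (s : ℤ) (N : ℕ) (G : ℕ → ℕ → Qq[X])
    (hG : ∀ a m, N ≤ a → G a m = 0) (hG' : ∀ a m, N ≤ m → G a m = 0) :
    Echeck ς * sumPBW ς s (N + 1) G =
      sumPBW ς s (N + 1) (fun a m =>
        (q ^ (2 * (a : ℤ) - 2 * s) * qInt m) • (G a (m - 1)).comp (C (q ^ 4) * X) +
          lowerPoly ς a * G (a + 1) m) := by
  have h1 : ∀ a, ∑ m ∈ Finset.range (N + 1), monomialPBW ς s a m
      ((q ^ (2 * (a : ℤ) - 2 * s) * qInt m) • (G a (m - 1)).comp (C (q ^ 4) * X)) =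
      ∑ m ∈ Finset.range (N + 1), monomialPBW ς s a (m + 1)
        ((q ^ (2 * (a : ℤ) - 2 * s) * qInt ((m : ℤ) + 1)) • (G a m).comp (C (q ^ 4) * X)) := by
    intro a
    rw [Finset.sum_range_succ', Finset.sum_range_succ]
    simp [hG', monomialPBW_zero, qInt_zero]
  simp only [← sumPBW_add]
  have h2 : sumPBW ς s (N + 1) (fun a m => lowerPoly ς a * G (a + 1) m) =
      ∑ a ∈ Finset.range N, ∑ m ∈ Finset.range (N + 1),
        monomialPBW ς s a m (lowerPoly ς a * G (a + 1) m) := by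
    rw [sumPBW, Finset.sum_range_succ]
    simp [hG, monomialPBW_zero]
  rw [h2, sumPBW, sumPBW, Finset.sum_congr rfl fun a _ => h1 a,
    Finset.sum_range_succ' (fun a => ∑ m ∈ Finset.range (N + 1), monomialPBW ς s a m (G a m)),
    Finset.sum_range_succ' (fun a => ∑ m ∈ Finset.range (N + 1), monomialPBW ς s a (m + 1) _),
    mul_add, Finset.mul_sum, add_right_comm, ← Finset.sum_add_distrib]
  simp only [Finset.mul_sum, Echeck_mul_monomialPBW_zero, Echeck_mul_monomialPBW_succ,
    Finset.sum_add_distrib]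

/-! ### The rational identities behind the recursion. -/

/-- The parities in the names are those of `n`, then `r`. The letters stand for `Q = q`, `A = q^a`,
`M = q^m`, `C = q^k`, `N = q^n`, `δ = (q - q⁻¹)⁻¹`, and `y` for a value of `K⁻²`. `A * M * C ^ 2 * Q
^ 2` is `q^r`, and the monomial in `A, M, Q` multiplying `y` inside the fractions is `q^(4e)`. `D`
stays opaque so that it is cleared as a denominator before being expanded. -/
theorem coef_identity_even_odd {R : Type*} [Field R] {Q A M C N D : R} (ς y δ : R) (hQ : Q ≠ 0)
    (hA : A ≠ 0) (hM : M ≠ 0) (hC : C ≠ 0) (hN : N ≠ 0) (hD : D ≠ 0) (h : D = C ^ 4 * Q ^ 4 - 1) :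
    δ * (N * Q - (N * Q)⁻¹) * (-(Q * ς)) * (C ^ 3 * Q ^ 3 * A * M) *
        (((A ^ 2 * M ^ 2 * Q ^ 2) * Q⁻¹ ^ 4 * y - 1) / D) =
      δ * (N * Q / (A * M * C ^ 2 * Q ^ 2) - (N * Q / (A * M * C ^ 2 * Q ^ 2))⁻¹) * A ^ 2 *
          (-(Q * ς)) * (C * Q) * (((A ^ 2 * M ^ 2 * Q ^ 2) * C ^ 4 * y - 1) / D) +
        δ * (A - A⁻¹) * (-(Q * ς)) * (C * Q * A * (A * M * C ^ 2 * Q ^ 2 / (N * Q))) *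
          (((A ^ 2 * M ^ 2 * Q ^ 2) * Q⁻¹ ^ 4 * y - 1) / D) +
        A ^ 2 * (A * M * C ^ 2 * Q ^ 2 / (N * Q))⁻¹ ^ 2 * (δ * (M - M⁻¹)) * (-(Q * ς)) *
          (C * Q * M * (A * M * C ^ 2 * Q ^ 2 / (N * Q))) * (((A ^ 2 * M ^ 2 * Q ^ 2) * C ^ 4 * y - 1) / D) +
        ς * (A ^ 2 * Q ^ 2) * δ * (A⁻¹ - A * y) *
          (C * A * M ^ 2 * Q * (N / (A * M * C ^ 2 * Q ^ 2))) +
        Q * ς * (δ * (N * Q ^ 2 / (A * M * C ^ 2 * Q ^ 2) -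
          (N * Q ^ 2 / (A * M * C ^ 2 * Q ^ 2))⁻¹)) * A ^ 2 * y * (C * A ^ 2 * M ^ 2) := by
  field_simp
  subst h
  ring

theorem coef_identity_even_even {R : Type*} [Field R] {Q A M C N D : R} (ς y δ : R) (hQ : Q ≠ 0)
    (hA : A ≠ 0) (hM : M ≠ 0) (hC : C ≠ 0) (hN : N ≠ 0) (hD : D ≠ 0) (h : D = C ^ 4 * Q ^ 4 - 1) :
    δ * (N * Q - (N * Q)⁻¹) * (-(Q * ς)) * (C ^ 3 * Q ^ 3 * A * M) *
        (((A ^ 2 * M ^ 2 * Q ^ 4) * Q⁻¹ ^ 4 * y - 1) / D) =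
      δ * (N * Q / (A * M * C ^ 2 * Q ^ 2) - (N * Q / (A * M * C ^ 2 * Q ^ 2))⁻¹) * A ^ 2 *
          (-(Q * ς)) * (C * Q) * (((A ^ 2 * M ^ 2 * Q ^ 4) * Q⁻¹ ^ 4 * y - 1) / D) +
        δ * (A - A⁻¹) * (-(Q * ς)) * (C * Q * A * (A * M * C ^ 2 * Q ^ 2 / (N * Q))) *
          (((A ^ 2 * M ^ 2 * Q ^ 4) * Q⁻¹ ^ 4 * y - 1) / D) +
        A ^ 2 * (A * M * C ^ 2 * Q ^ 2 / (N * Q))⁻¹ ^ 2 * (δ * (M - M⁻¹)) * (-(Q * ς)) *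
          (C * Q * M * (A * M * C ^ 2 * Q ^ 2 / (N * Q))) * (((A ^ 2 * M ^ 2 * Q ^ 4) * C ^ 4 * y - 1) / D) +
        ς * (A ^ 2 * Q ^ 2) * δ * (A⁻¹ - A * y) *
          (C * A * M ^ 2 * Q * (N / (A * M * C ^ 2 * Q ^ 2))) := by
  field_simp
  subst h
  ring

theorem coef_identity_odd_odd {R : Type*} [Field R] {Q A M C N D : R} (ς y δ : R) (hQ : Q ≠ 0)
    (hA : A ≠ 0) (hM : M ≠ 0) (hC : C ≠ 0) (hN : N ≠ 0) (hD : D ≠ 0) (h : D = C ^ 4 * Q ^ 4 - 1) :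
    δ * (N * Q - (N * Q)⁻¹) * (-(Q * ς)) * (C * Q * A * M) *
        (((A ^ 2 * M ^ 2 * Q ^ 2) * C ^ 4 * y - 1) / D) =
      δ * (N * Q / (A * M * C ^ 2 * Q ^ 2) - (N * Q / (A * M * C ^ 2 * Q ^ 2))⁻¹) * A ^ 2 *
          (-(Q * ς)) * (C ^ 3 * Q ^ 3) * (((A ^ 2 * M ^ 2 * Q ^ 2) * Q⁻¹ ^ 4 * y - 1) / D) +
        δ * (A - A⁻¹) * (-(Q * ς)) * (C ^ 3 * Q ^ 3 * A * (A * M * C ^ 2 * Q ^ 2 / (N * Q))) *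
          (((A ^ 2 * M ^ 2 * Q ^ 2) * Q⁻¹ ^ 4 * y - 1) / D) +
        A ^ 2 * (A * M * C ^ 2 * Q ^ 2 / (N * Q))⁻¹ ^ 2 * (δ * (M - M⁻¹)) * (-(Q * ς)) *
          (C ^ 3 * Q ^ 3 * M * (A * M * C ^ 2 * Q ^ 2 / (N * Q))) * (((A ^ 2 * M ^ 2 * Q ^ 2) * C ^ 4 * y - 1) / D) +
        ς * (A ^ 2 * Q ^ 2) * δ * (A⁻¹ - A * y) *
          (C ^ 3 * A * M ^ 2 * Q * (N / (A * M * C ^ 2 * Q ^ 2))) -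
        Q * ς * (δ * (N - N⁻¹)) * (C * A * M) := by
  field_simp
  subst h
  ring

theorem coef_identity_odd_even {R : Type*} [Field R] {Q A M C N D : R} (ς y δ : R) (hQ : Q ≠ 0)
    (hA : A ≠ 0) (hM : M ≠ 0) (hC : C ≠ 0) (hN : N ≠ 0) (hD : D ≠ 0) (h : D = C ^ 4 * Q ^ 4 - 1) :
    δ * (N * Q - (N * Q)⁻¹) * (-(Q * ς)) * (C * Q * A * M) *
        (((A ^ 2 * M ^ 2) * C ^ 4 * y - 1) / D) =
      δ * (N * Q / (A * M * C ^ 2 * Q ^ 2) - (N * Q / (A * M * C ^ 2 * Q ^ 2))⁻¹) * A ^ 2 *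
          (-(Q * ς)) * (C ^ 3 * Q ^ 3) * (((A ^ 2 * M ^ 2) * C ^ 4 * y - 1) / D) +
        δ * (A - A⁻¹) * (-(Q * ς)) * (C ^ 3 * Q ^ 3 * A * (A * M * C ^ 2 * Q ^ 2 / (N * Q))) *
          (((A ^ 2 * M ^ 2) * Q⁻¹ ^ 4 * y - 1) / D) +
        A ^ 2 * (A * M * C ^ 2 * Q ^ 2 / (N * Q))⁻¹ ^ 2 * (δ * (M - M⁻¹)) * (-(Q * ς)) *
          (C ^ 3 * Q ^ 3 * M * (A * M * C ^ 2 * Q ^ 2 / (N * Q))) * (((A ^ 2 * M ^ 2) * C ^ 4 * y - 1) / D) +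
        ς * (A ^ 2 * Q ^ 2) * δ * (A⁻¹ - A * y) *
          (C ^ 3 * A * M ^ 2 * Q * (N / (A * M * C ^ 2 * Q ^ 2))) +
        Q * ς * (δ * (N * Q ^ 2 / (A * M * C ^ 2 * Q ^ 2) -
          (N * Q ^ 2 / (A * M * C ^ 2 * Q ^ 2))⁻¹)) * A ^ 2 * y * (C ^ 3 * A ^ 2 * M ^ 2) -
        Q * ς * (δ * (N - N⁻¹)) * (C * A * M) := by
  field_simp
  subst h
  ring

theorem coef_identity_zero {R : Type*} [Field R] {Q A M N : R} (δ : R) (hQ : Q ≠ 0)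
    (hA : A ≠ 0) (hM : M ≠ 0) (hN : N ≠ 0) :
    δ * (N * Q - (N * Q)⁻¹) * (A * M) =
      δ * (N * Q / (A * M) - (N * Q / (A * M))⁻¹) * A ^ 2 +
        δ * (A - A⁻¹) * (A * (A * M / (N * Q))) +
        A ^ 2 * (A * M / (N * Q))⁻¹ ^ 2 * (δ * (M - M⁻¹)) * (M * (A * M / (N * Q))) := by
  field_simp
  ring

/-! ### The elements `[h; e, c]` as polynomials in `K⁻²`. -/

/-- The polynomial whose value at `K⁻²` is `[h; e, c]`. -/
def hPoly (e : ℤ) (c : ℕ) : Qq[X] :=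
  ∏ j ∈ Finset.range c, (q ^ (4 * (j + 1)) - 1)⁻¹ • (q ^ (4 * e + 4 * (j : ℤ)) • X - 1)

theorem hBinom_succ (e : ℤ) (c : ℕ) :
    hBinom e (c + 1) = hBinom e c *
      ((q ^ (4 * (c + 1)) - 1)⁻¹ • (q ^ (4 * e + 4 * (c : ℤ)) • Kinvsq - 1)) := by
  simp only [hBinom, bind_pure_comp, List.map_eq_map, List.map_map, List.range_succ,
    List.map_append, List.prod_append, List.map_cons, List.map_nil, List.prod_singleton, Kinvsq]
  norm_cast

theorem aeval_hPoly (e : ℤ) (c : ℕ) : aeval Kinvsq (hPoly e c) = hBinom e c := by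
  induction c with
  | zero => simp [hPoly, hBinom]
  | succ c ih =>
    rw [hPoly, Finset.prod_range_succ, map_mul, ← hPoly, ih, hBinom_succ]
    simp

theorem eval_hPoly_succ_top (e : ℤ) (k : ℕ) (y : Qq) :
    (hPoly e (k + 1)).eval y =
      (q ^ (4 * e) * (q ^ k) ^ 4 * y - 1) / ((q ^ k) ^ 4 * q ^ 4 - 1) * (hPoly e k).eval y := by
  rw [hPoly, Finset.prod_range_succ, ← hPoly, eval_mul, mul_comm]
  simp only [eval_smul, eval_sub, eval_X, eval_one, smul_eq_mul]
  rw [zpow_add₀ q_ne_zero, q_zpow_four_mul (k : ℤ), zpow_natCast, mul_add, pow_add, mul_comm 4 k,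
    pow_mul, mul_one, div_eq_inv_mul]

theorem eval_hPoly_mul (e : ℤ) (c : ℕ) (y : Qq) :
    (hPoly e c).eval (q ^ 4 * y) = (hPoly (e + 1) c).eval y := by
  simp only [hPoly, eval_prod, eval_smul, eval_sub, eval_X, eval_one, smul_eq_mul]
  refine Finset.prod_congr rfl fun j _ => ?_
  have h : q ^ (4 * e + 4 * (j : ℤ)) * q ^ 4 = q ^ (4 * (e + 1) + 4 * (j : ℤ)) := by
    rw [← zpow_natCast, ← zpow_add₀ q_ne_zero]
    congr 1
    push_cast
    ring
  rw [← mul_assoc, h]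

theorem q_pow_mul_sub_one_ne_zero (k : ℕ) : (q ^ k) ^ 4 * q ^ 4 - 1 ≠ 0 := by
  rw [← pow_mul, ← pow_add]
  exact sub_ne_zero.2 (q_pow_ne_one (by omega))

/-- The numerators with parameter `e - 1` are those with parameter `e` preceded by one new factor,
while the denominators depend only on the length. Together with `eval_hPoly_succ_top`, this reduces
both `hPoly e (k + 1)` and `hPoly (e - 1) (k + 1)` to `hPoly e k`. -/
theorem eval_hPoly_succ_bot (e : ℤ) (k : ℕ) (y : Qq) :
    (hPoly (e - 1) (k + 1)).eval y =
      (q ^ (4 * e) * q⁻¹ ^ 4 * y - 1) / ((q ^ k) ^ 4 * q ^ 4 - 1) * (hPoly e k).eval y := by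
  have hq := q_ne_zero
  induction k with
  | zero =>
    rw [eval_hPoly_succ_top]
    simp only [hPoly, Finset.prod_range_zero, eval_one, mul_sub, zpow_sub₀ hq, pow_zero, one_pow,
      mul_one]
    congr 4
    rw [div_eq_mul_inv]
    congr 1
    rw [inv_pow]
    norm_cast
  | succ k ih =>
    have h1 := q_pow_mul_sub_one_ne_zero k
    have h2 := q_pow_mul_sub_one_ne_zero (k + 1)
    rw [eval_hPoly_succ_top, ih, eval_hPoly_succ_top]
    have h3 : q ^ (4 * (e - 1)) * (q ^ (k + 1)) ^ 4 = q ^ (4 * e) * (q ^ k) ^ 4 := by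
      have : q ^ ((4 : ℤ) * 1) = q ^ 4 := by norm_cast
      rw [mul_sub, zpow_sub₀ hq, pow_succ q k, mul_pow (q ^ k) q 4, this]
      field_simp
    rw [h3]
    ring

/-! ### The coefficients and their recursion. -/

/-- The index `⌊(r - 1) / 2⌋` or `⌊(r - 2) / 2⌋`, according to the parity of `n`. -/
def topIndex (n r : ℤ) : ℤ := if Even n then (r - 1) / 2 else (r - 2) / 2

/-- The coefficient of `F^(a) K^(r-n) Ě^(m)` with `r = a + m + 2 c`, as a polynomial in `K⁻²`. -/
def coefPoly (ς : Qq) (n r a m : ℤ) (c : ℕ) : Qq[X] :=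
  ((-1) ^ c * q ^ ((if Even n then (c : ℤ) else 3 * c) - (a + m) * (r - n) + a * m) *
    (q * ς) ^ c) • hPoly (1 - c + topIndex n r) c

/-- The coefficient of `F^(a) K^(r-n) Ě^(m)`, as a polynomial in `K⁻²`. -/
def coef (ς : Qq) (n r : ℤ) (a m : ℕ) : Qq[X] :=
  if (a : ℤ) + m ≤ r ∧ Even (r - a - m) then coefPoly ς n r a m ((r - a - m) / 2).toNat else 0

theorem coef_eq (ς : Qq) (n : ℤ) {r : ℤ} {a m c : ℕ} (h : r = a + m + 2 * c) :
    coef ς n r a m = coefPoly ς n r a m c := by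
  have h1 : ((r - a - m) / 2).toNat = c := by omega
  rw [coef, if_pos ⟨by omega, by rw [Int.even_iff]; omega⟩, h1]

theorem coef_eq_zero (ς : Qq) (n : ℤ) {r : ℤ} {a m : ℕ} (h : ∀ c : ℕ, r ≠ a + m + 2 * c) :
    coef ς n r a m = 0 := by
  rw [coef, if_neg]
  rintro ⟨h1, h2⟩
  rw [Int.even_iff] at h2
  exact h ((r - a - m) / 2).toNat (by omega)

theorem coef_of_lt (ς : Qq) (n : ℤ) {r : ℤ} {a m : ℕ} (h : r < a + m) : coef ς n r a m = 0 :=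
  coef_eq_zero ς n fun c => by omega

/-- Replaces the truncated `a - 1` by the integer one; they differ only at `a = 0`, where `[0]`
kills both sides. -/
theorem qInt_smul_coef_pred_left (ς : Qq) (n : ℤ) {r : ℤ} {a m c : ℕ} (h : r = a + m + 2 * c) :
    qInt a • coef ς n (r - 1) (a - 1) m = qInt a • coefPoly ς n (r - 1) (a - 1) m c := by
  rcases a with _ | a
  · simp [qInt_zero]
  · rw [coef_eq ς n (c := c) (by omega)]
    simp

theorem qInt_smul_coef_pred_right (ς : Qq) (n : ℤ) {r : ℤ} {a m c : ℕ} (h : r = a + m + 2 * c)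
    (x : Qq) :
    (x * qInt m) • (coef ς n (r - 1) a (m - 1)).comp (C (q ^ 4) * X) =
      (x * qInt m) • (coefPoly ς n (r - 1) a (m - 1) c).comp (C (q ^ 4) * X) := by
  rcases m with _ | m
  · simp [qInt_zero]
  · rw [coef_eq ς n (c := c) (by omega)]
    simp

theorem eval_lowerPoly (ς : Qq) (a : ℕ) (y : Qq) :
    (lowerPoly ς a).eval y = ς * ((q ^ (a : ℤ)) ^ 2 * q ^ 2) * (q - q⁻¹)⁻¹ *
      ((q ^ (a : ℤ))⁻¹ - q ^ (a : ℤ) * y) := by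
  rw [lowerPoly]
  simp only [eval_smul, eval_sub, eval_mul, eval_C, eval_X, smul_eq_mul]
  rw [zpow_add₀ q_ne_zero, q_zpow_two_mul, zpow_neg]
  norm_cast

theorem eval_coefPoly (ς : Qq) (n r a m : ℤ) (c : ℕ) (y : Qq) :
    (coefPoly ς n r a m c).eval y =
      (-1) ^ c * q ^ ((if Even n then (c : ℤ) else 3 * c) - (a + m) * (r - n) + a * m) *
        (q * ς) ^ c * (hPoly (1 - c + topIndex n r) c).eval y := by
  rw [coefPoly, eval_smul, smul_eq_mul]

theorem qInt_eq (n : ℤ) : qInt n = (q - q⁻¹)⁻¹ * (q ^ n - (q ^ n)⁻¹) := by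
  rw [qInt, zpow_neg, div_eq_inv_mul]

theorem coefPoly_recursion_zero (ς : Qq) (n r a m : ℤ) (y : Qq) (h : r = a + m) :
    qInt (n + 1) * (coefPoly ς (n + 1) r a m 0).eval y =
      qInt (n + 1 - r) * q ^ (2 * a) * (coefPoly ς n r a m 0).eval y +
        qInt a * (coefPoly ς n (r - 1) (a - 1) m 0).eval y +
        q ^ (2 * a - 2 * (r - 1 - n)) * qInt m *
          (coefPoly ς n (r - 1) a (m - 1) 0).eval (q ^ 4 * y) := by
  have hq := q_ne_zero
  subst h
  simp only [eval_coefPoly, qInt_eq, hPoly, Finset.prod_range_zero, eval_one, pow_zero, one_mul,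
    mul_one, Nat.cast_zero, mul_zero, ite_self, zero_sub]
  have e1 : q ^ (-((a + m) * (a + m - (n + 1))) + a * m) =
      q ^ (-((a + m) * (a + m - n)) + a * m) * (q ^ a * q ^ m) := by
    simp only [← zpow_add₀ hq]
    congr 1
    ring
  have e2 : q ^ (-((a - 1 + m) * (a + m - 1 - n)) + (a - 1) * m) =
      q ^ (-((a + m) * (a + m - n)) + a * m) * (q ^ a * (q ^ a * q ^ m / (q ^ n * q))) := by
    simp only [← zpow_add₀ hq, ← zpow_add_one₀ hq, ← zpow_sub₀ hq]
    congr 1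
    ring
  have e3 : q ^ (-((a + (m - 1)) * (a + m - 1 - n)) + a * (m - 1)) =
      q ^ (-((a + m) * (a + m - n)) + a * m) * (q ^ m * (q ^ a * q ^ m / (q ^ n * q))) := by
    simp only [← zpow_add₀ hq, ← zpow_add_one₀ hq, ← zpow_sub₀ hq]
    congr 1
    ring
  have e4 : q ^ (n + 1 - (a + m)) = q ^ n * q / (q ^ a * q ^ m) := by
    simp only [← zpow_add₀ hq, ← zpow_add_one₀ hq, ← zpow_sub₀ hq]
  have e5 : q ^ (2 * a - 2 * (a + m - 1 - n)) =
      (q ^ a) ^ 2 * (q ^ a * q ^ m / (q ^ n * q))⁻¹ ^ 2 := by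
    rw [← zpow_add₀ hq, ← zpow_add_one₀ hq, ← zpow_sub₀ hq, ← zpow_neg, zpow_sub₀ hq,
      q_zpow_two_mul, q_zpow_two_mul, zpow_neg, inv_pow, div_eq_mul_inv]
    congr 4
    ring
  rw [e1, e2, e3, e4, e5, q_zpow_two_mul, zpow_add_one₀ hq]
  linear_combination q ^ (-((a + m) * (a + m - n)) + a * m) *
    coef_identity_zero (q - q⁻¹)⁻¹ hq (zpow_ne_zero a hq) (zpow_ne_zero m hq) (zpow_ne_zero n hq)

set_option linter.unusedSimpArgs false in
theorem coefPoly_recursion_succ (ς : Qq) (n r a m : ℤ) (k : ℕ) (y : Qq)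
    (h : r = a + m + 2 * (k + 1)) :
    qInt (n + 1) * (coefPoly ς (n + 1) r a m (k + 1)).eval y =
      qInt (n + 1 - r) * q ^ (2 * a) * (coefPoly ς n r a m (k + 1)).eval y +
        qInt a * (coefPoly ς n (r - 1) (a - 1) m (k + 1)).eval y +
        q ^ (2 * a - 2 * (r - 1 - n)) * qInt m *
          (coefPoly ς n (r - 1) a (m - 1) (k + 1)).eval (q ^ 4 * y) +
        ς * ((q ^ a) ^ 2 * q ^ 2) * (q - q⁻¹)⁻¹ * ((q ^ a)⁻¹ - q ^ a * y) *
          (coefPoly ς n (r - 1) (a + 1) m k).eval y +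
        (if Odd (n - r) then q * ς * qInt (n - r + 2) * q ^ (2 * a) * y *
          (coefPoly ς n (r - 2) a m k).eval y else 0) -
        (if Odd n then q * ς * qInt n * (coefPoly ς (n - 1) (r - 2) a m k).eval y else 0) := by
  have hq := q_ne_zero
  have hA := zpow_ne_zero a hq
  have hM := zpow_ne_zero m hq
  have hN := zpow_ne_zero n hq
  have hC := pow_ne_zero k hq
  have hD := q_pow_mul_sub_one_ne_zero k
  have er : q ^ r = q ^ a * q ^ m * (q ^ k) ^ 2 * q ^ 2 := by
    simp only [← zpow_natCast, ← zpow_mul, ← zpow_add₀ hq]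
    congr 1
    push_cast
    linarith
  have e4 : q ^ (n + 1 - r) = q ^ n * q / (q ^ a * q ^ m * (q ^ k) ^ 2 * q ^ 2) := by
    rw [← er, zpow_sub₀ hq, zpow_add_one₀ hq]
  have e4' : q ^ (n - r + 2) = q ^ n * q ^ 2 / (q ^ a * q ^ m * (q ^ k) ^ 2 * q ^ 2) := by
    rw [← er, zpow_add₀ hq, zpow_sub₀ hq, zpow_ofNat]
    ring
  have e5 : q ^ (2 * a - 2 * (r - 1 - n)) =
      (q ^ a) ^ 2 * (q ^ a * q ^ m * (q ^ k) ^ 2 * q ^ 2 / (q ^ n * q))⁻¹ ^ 2 := by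
    rw [← er, zpow_sub₀ hq, q_zpow_two_mul, q_zpow_two_mul, zpow_sub₀ hq, zpow_sub₀ hq, zpow_one]
    field_simp
  have hk : ((k + 1 : ℕ) : ℤ) = k + 1 := by push_cast; rfl
  simp only [eval_coefPoly, eval_hPoly_mul, qInt_eq, hk]
  rcases Int.even_or_odd n with hn | hn
  · have hn1 : ¬ Even (n + 1) := by rw [Int.even_iff] at *; omega
    have hn0 : ¬ Odd n := by rwa [Int.not_odd_iff_even]
    simp only [if_pos hn, if_neg hn1, if_neg hn0, topIndex, sub_zero]
    -- Every power of `q` is written relative to the common `q^(-(a+m)(r-n)+am)`, so that this power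
    -- can be factored out at the end.
    have x1 : q ^ (3 * ((k : ℤ) + 1) - (a + m) * (r - (n + 1)) + a * m) =
        q ^ (-((a + m) * (r - n)) + a * m) * ((q ^ k) ^ 3 * q ^ 3 * q ^ a * q ^ m) := by
      simp only [← zpow_natCast, ← zpow_mul, ← zpow_add₀ hq, ← zpow_add_one₀ hq, ← zpow_sub₀ hq]
      congr 1
      push_cast
      ring
    have x2 : q ^ (((k : ℤ) + 1) - (a + m) * (r - n) + a * m) =
        q ^ (-((a + m) * (r - n)) + a * m) * (q ^ k * q) := by
      simp only [← zpow_natCast, ← zpow_mul, ← zpow_add₀ hq, ← zpow_add_one₀ hq, ← zpow_sub₀ hq]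
      congr 1
      ring
    have x3 : q ^ (((k : ℤ) + 1) - (a - 1 + m) * (r - 1 - n) + (a - 1) * m) =
        q ^ (-((a + m) * (r - n)) + a * m) * (q ^ k * q * q ^ a * (q ^ r / (q ^ n * q))) := by
      simp only [← zpow_natCast, ← zpow_mul, ← zpow_add₀ hq, ← zpow_add_one₀ hq, ← zpow_sub₀ hq]
      congr 1
      ring
    have x4 : q ^ (((k : ℤ) + 1) - (a + (m - 1)) * (r - 1 - n) + a * (m - 1)) =
        q ^ (-((a + m) * (r - n)) + a * m) * (q ^ k * q * q ^ m * (q ^ r / (q ^ n * q))) := by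
      simp only [← zpow_natCast, ← zpow_mul, ← zpow_add₀ hq, ← zpow_add_one₀ hq, ← zpow_sub₀ hq]
      congr 1
      ring
    have x5 : q ^ ((k : ℤ) - (a + 1 + m) * (r - 1 - n) + (a + 1) * m) =
        q ^ (-((a + m) * (r - n)) + a * m) * (q ^ k * q ^ a * (q ^ m) ^ 2 * q * (q ^ n / q ^ r)) := by
      simp only [← zpow_natCast, ← zpow_mul, ← zpow_add₀ hq, ← zpow_add_one₀ hq, ← zpow_sub₀ hq]
      congr 1
      push_cast
      ring
    have x6 : q ^ ((k : ℤ) - (a + m) * (r - 2 - n) + a * m) =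
        q ^ (-((a + m) * (r - n)) + a * m) * (q ^ k * (q ^ a) ^ 2 * (q ^ m) ^ 2) := by
      simp only [← zpow_natCast, ← zpow_mul, ← zpow_add₀ hq, ← zpow_add_one₀ hq, ← zpow_sub₀ hq]
      congr 1
      push_cast
      ring
    rcases Int.even_or_odd r with hr | hr
    · have hr' := Int.even_iff.1 hr
      have hn' := Int.even_iff.1 hn
      -- `e` is chosen so that all products of length `k` have parameter `e`; those of length `k +
      -- 1` then have parameter `e` or `e - 1`.
      obtain ⟨e, he⟩ : ∃ e : ℤ, e = (r - 2) / 2 - k + 1 := ⟨_, rfl⟩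
      have hz : q ^ (4 * e) = (q ^ a) ^ 2 * (q ^ m) ^ 2 * q ^ 4 := by
        simp only [← zpow_natCast, ← zpow_mul, ← zpow_add₀ hq]
        congr 1
        push_cast
        omega
      have i1 : 1 - ((k : ℤ) + 1) + (r - 2) / 2 = e - 1 := by omega
      have i2 : 1 - ((k : ℤ) + 1) + (r - 1) / 2 = e - 1 := by omega
      have i3 : 1 - ((k : ℤ) + 1) + (r - 1 - 1) / 2 = e - 1 := by omega
      have i5 : 1 - (k : ℤ) + (r - 1 - 1) / 2 = e := by omega
      have hnr : ¬ Odd (n - r) := by rw [Int.odd_iff]; omega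
      rw [if_neg hnr, i1, i2, i3, i5, sub_add_cancel, x1, x2, x3, x4, x5]
      -- This must precede `eval_hPoly_succ_top`, which would also match the parameter `e - 1` and
      -- leave `hPoly (e - 1) k`.
      simp only [eval_hPoly_succ_bot]
      simp only [eval_hPoly_succ_top, hz, e4, e5, er, q_zpow_two_mul, zpow_add_one₀ hq, pow_succ (-1 : Qq), pow_succ (q * ς)]
      linear_combination (-1) ^ k * (q * ς) ^ k * q ^ (-((a + m) * (r - n)) + a * m) * (hPoly e k).eval y *
        coef_identity_even_even ς y (q - q⁻¹)⁻¹ hq hA hM hC hN hD rfl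
    · have hr' := Int.odd_iff.1 hr
      have hn' := Int.even_iff.1 hn
      obtain ⟨e, he⟩ : ∃ e : ℤ, e = (r - 1) / 2 - k := ⟨_, rfl⟩
      have hz : q ^ (4 * e) = (q ^ a) ^ 2 * (q ^ m) ^ 2 * q ^ 2 := by
        simp only [← zpow_natCast, ← zpow_mul, ← zpow_add₀ hq]
        congr 1
        push_cast
        omega
      have i1 : 1 - ((k : ℤ) + 1) + (r - 2) / 2 = e - 1 := by omega
      have i2 : 1 - ((k : ℤ) + 1) + (r - 1) / 2 = e := by omega
      have i3 : 1 - ((k : ℤ) + 1) + (r - 1 - 1) / 2 = e - 1 := by omega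
      have i5 : 1 - (k : ℤ) + (r - 1 - 1) / 2 = e := by omega
      have i6 : 1 - (k : ℤ) + (r - 2 - 1) / 2 = e := by omega
      have hnr : Odd (n - r) := by rw [Int.odd_iff]; omega
      rw [if_pos hnr, i1, i2, i3, i5, i6, sub_add_cancel, x1, x2, x3, x4, x5, x6]
      simp only [eval_hPoly_succ_bot]
      simp only [eval_hPoly_succ_top, hz, e4, e4', e5, er, q_zpow_two_mul, zpow_add_one₀ hq, pow_succ (-1 : Qq), pow_succ (q * ς)]
      linear_combination (-1) ^ k * (q * ς) ^ k * q ^ (-((a + m) * (r - n)) + a * m) * (hPoly e k).eval y *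
        coef_identity_even_odd ς y (q - q⁻¹)⁻¹ hq hA hM hC hN hD rfl
  · have hn1 : Even (n + 1) := by rw [Int.even_iff, Int.odd_iff] at *; omega
    have hn2 : Even (n - 1) := by rw [Int.even_iff, Int.odd_iff] at *; omega
    have hn0 : ¬ Even n := by rwa [Int.not_even_iff_odd]
    simp only [if_pos hn, if_pos hn1, if_pos hn2, if_neg hn0, topIndex]
    have x1 : q ^ (((k : ℤ) + 1) - (a + m) * (r - (n + 1)) + a * m) =
        q ^ (-((a + m) * (r - n)) + a * m) * (q ^ k * q * q ^ a * q ^ m) := by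
      simp only [← zpow_natCast, ← zpow_mul, ← zpow_add₀ hq, ← zpow_add_one₀ hq, ← zpow_sub₀ hq]
      congr 1
      ring
    have x2 : q ^ (3 * ((k : ℤ) + 1) - (a + m) * (r - n) + a * m) =
        q ^ (-((a + m) * (r - n)) + a * m) * ((q ^ k) ^ 3 * q ^ 3) := by
      simp only [← zpow_natCast, ← zpow_mul, ← zpow_add₀ hq, ← zpow_add_one₀ hq, ← zpow_sub₀ hq]
      congr 1
      push_cast
      ring
    have x3 : q ^ (3 * ((k : ℤ) + 1) - (a - 1 + m) * (r - 1 - n) + (a - 1) * m) =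
        q ^ (-((a + m) * (r - n)) + a * m) * ((q ^ k) ^ 3 * q ^ 3 * q ^ a * (q ^ r / (q ^ n * q))) := by
      simp only [← zpow_natCast, ← zpow_mul, ← zpow_add₀ hq, ← zpow_add_one₀ hq, ← zpow_sub₀ hq]
      congr 1
      push_cast
      ring
    have x4 : q ^ (3 * ((k : ℤ) + 1) - (a + (m - 1)) * (r - 1 - n) + a * (m - 1)) =
        q ^ (-((a + m) * (r - n)) + a * m) * ((q ^ k) ^ 3 * q ^ 3 * q ^ m * (q ^ r / (q ^ n * q))) := by
      simp only [← zpow_natCast, ← zpow_mul, ← zpow_add₀ hq, ← zpow_add_one₀ hq, ← zpow_sub₀ hq]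
      congr 1
      push_cast
      ring
    have x5 : q ^ (3 * (k : ℤ) - (a + 1 + m) * (r - 1 - n) + (a + 1) * m) =
        q ^ (-((a + m) * (r - n)) + a * m) * ((q ^ k) ^ 3 * q ^ a * (q ^ m) ^ 2 * q * (q ^ n / q ^ r)) := by
      simp only [← zpow_natCast, ← zpow_mul, ← zpow_add₀ hq, ← zpow_add_one₀ hq, ← zpow_sub₀ hq]
      congr 1
      push_cast
      ring
    have x6 : q ^ (3 * (k : ℤ) - (a + m) * (r - 2 - n) + a * m) =
        q ^ (-((a + m) * (r - n)) + a * m) * ((q ^ k) ^ 3 * (q ^ a) ^ 2 * (q ^ m) ^ 2) := by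
      simp only [← zpow_natCast, ← zpow_mul, ← zpow_add₀ hq, ← zpow_add_one₀ hq, ← zpow_sub₀ hq]
      congr 1
      push_cast
      ring
    have x7 : q ^ ((k : ℤ) - (a + m) * (r - 2 - (n - 1)) + a * m) =
        q ^ (-((a + m) * (r - n)) + a * m) * (q ^ k * q ^ a * q ^ m) := by
      simp only [← zpow_natCast, ← zpow_mul, ← zpow_add₀ hq, ← zpow_add_one₀ hq, ← zpow_sub₀ hq]
      congr 1
      ring
    rcases Int.even_or_odd r with hr | hr
    · have hr' := Int.even_iff.1 hr
      have hn' := Int.odd_iff.1 hn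
      obtain ⟨e, he⟩ : ∃ e : ℤ, e = (r - 2) / 2 - k := ⟨_, rfl⟩
      have hz : q ^ (4 * e) = (q ^ a) ^ 2 * (q ^ m) ^ 2 := by
        simp only [← zpow_natCast, ← zpow_mul, ← zpow_add₀ hq]
        congr 1
        push_cast
        omega
      have i1 : 1 - ((k : ℤ) + 1) + (r - 1) / 2 = e := by omega
      have i2 : 1 - ((k : ℤ) + 1) + (r - 2) / 2 = e := by omega
      have i3 : 1 - ((k : ℤ) + 1) + (r - 1 - 2) / 2 = e - 1 := by omega
      have i5 : 1 - (k : ℤ) + (r - 1 - 2) / 2 = e := by omega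
      have i6 : 1 - (k : ℤ) + (r - 2 - 2) / 2 = e := by omega
      have i7 : 1 - (k : ℤ) + (r - 2 - 1) / 2 = e := by omega
      have hnr : Odd (n - r) := by rw [Int.odd_iff]; omega
      rw [if_pos hnr, i1, i2, i3, i5, i6, i7, sub_add_cancel, x1, x2, x3, x4, x5, x6, x7]
      simp only [eval_hPoly_succ_bot]
      simp only [eval_hPoly_succ_top, hz, e4, e4', e5, er, q_zpow_two_mul, zpow_add_one₀ hq, pow_succ (-1 : Qq), pow_succ (q * ς)]
      linear_combination (-1) ^ k * (q * ς) ^ k * q ^ (-((a + m) * (r - n)) + a * m) * (hPoly e k).eval y *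
        coef_identity_odd_even ς y (q - q⁻¹)⁻¹ hq hA hM hC hN hD rfl
    · have hr' := Int.odd_iff.1 hr
      have hn' := Int.odd_iff.1 hn
      obtain ⟨e, he⟩ : ∃ e : ℤ, e = (r - 1) / 2 - k := ⟨_, rfl⟩
      have hz : q ^ (4 * e) = (q ^ a) ^ 2 * (q ^ m) ^ 2 * q ^ 2 := by
        simp only [← zpow_natCast, ← zpow_mul, ← zpow_add₀ hq]
        congr 1
        push_cast
        omega
      have i1 : 1 - ((k : ℤ) + 1) + (r - 1) / 2 = e := by omega
      have i2 : 1 - ((k : ℤ) + 1) + (r - 2) / 2 = e - 1 := by omega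
      have i3 : 1 - ((k : ℤ) + 1) + (r - 1 - 2) / 2 = e - 1 := by omega
      have i5 : 1 - (k : ℤ) + (r - 1 - 2) / 2 = e := by omega
      have i7 : 1 - (k : ℤ) + (r - 2 - 1) / 2 = e := by omega
      have hnr : ¬ Odd (n - r) := by rw [Int.odd_iff]; omega
      rw [if_neg hnr, i1, i2, i3, i5, i7, sub_add_cancel, x1, x2, x3, x4, x5, x7]
      simp only [eval_hPoly_succ_bot]
      simp only [eval_hPoly_succ_top, hz, e4, e5, er, q_zpow_two_mul, zpow_add_one₀ hq, pow_succ (-1 : Qq), pow_succ (q * ς)]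
      linear_combination (-1) ^ k * (q * ς) ^ k * q ^ (-((a + m) * (r - n)) + a * m) * (hPoly e k).eval y *
        coef_identity_odd_odd ς y (q - q⁻¹)⁻¹ hq hA hM hC hN hD rfl

theorem coef_recursion (ς : Qq) (n r : ℤ) (a m : ℕ) :
    qInt (n + 1) • coef ς (n + 1) r a m =
      (qInt (n + 1 - r) * q ^ (2 * (a : ℤ))) • coef ς n r a m +
        (qInt a • coef ς n (r - 1) (a - 1) m +
          ((q ^ (2 * (a : ℤ) - 2 * (r - 1 - n)) * qInt m) •
            (coef ς n (r - 1) a (m - 1)).comp (C (q ^ 4) * X) +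
          lowerPoly ς a * coef ς n (r - 1) (a + 1) m)) +
        (if Odd (n - r) then q * ς * qInt (n - r + 2) * q ^ (2 * (a : ℤ)) else 0) •
          (X * coef ς n (r - 2) a m) -
        (if Odd n then q * ς * qInt n else 0) • coef ς (n - 1) (r - 2) a m := by
  by_cases h : ∃ c : ℕ, r = a + m + 2 * c
  · obtain ⟨c, h⟩ := h
    rw [qInt_smul_coef_pred_left ς n h, qInt_smul_coef_pred_right ς n h, coef_eq ς _ h,
      coef_eq ς _ h]
    -- The field is infinite, so polynomials agreeing at every `y` are equal.
    refine Polynomial.funext fun y => ?_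
    rcases c with _ | k
    -- For `c = 0`, the terms that would need `c - 1` vanish by degree.
    · rw [coef_of_lt ς n (r := r - 1) (by push_cast at *; omega),
        coef_of_lt ς n (r := r - 2) (by push_cast at *; omega),
        coef_of_lt ς (n - 1) (r := r - 2) (by push_cast at *; omega)]
      have := coefPoly_recursion_zero ς n r a m y (by push_cast at h; omega)
      simp only [eval_add, eval_smul, eval_comp, eval_mul, eval_C, eval_X, smul_eq_mul,
        mul_zero, smul_zero, add_zero, sub_zero, this]
      ring
    · have h1 : r - 1 = ((a + 1 : ℕ) : ℤ) + m + 2 * k := by push_cast at *; omega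
      have h2 : r - 2 = (a : ℤ) + m + 2 * k := by push_cast at *; omega
      rw [coef_eq ς n h1, coef_eq ς n h2, coef_eq ς (n - 1) h2]
      have := coefPoly_recursion_succ ς n r a m k y (by push_cast at h; omega)
      simp only [eval_add, eval_sub, eval_smul, eval_comp, eval_mul, eval_C, eval_X, smul_eq_mul,
        this, eval_lowerPoly, ite_mul, zero_mul, Nat.cast_add, Nat.cast_one]
      split_ifs <;> ring
  · push Not at h
    have hF : qInt a • coef ς n (r - 1) (a - 1) m = 0 := by
      rcases a with _ | a
      · simp [qInt_zero]
      · rw [coef_eq_zero, smul_zero]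
        intro c hc
        exact h c (by omega)
    have hE : (q ^ (2 * (a : ℤ) - 2 * (r - 1 - n)) * qInt m) •
        (coef ς n (r - 1) a (m - 1)).comp (C (q ^ 4) * X) = 0 := by
      rcases m with _ | m
      · simp [qInt_zero]
      · rw [coef_eq_zero, zero_comp, smul_zero]
        intro c hc
        exact h c (by omega)
    rw [hF, hE, coef_eq_zero ς _ h, coef_eq_zero ς _ h,
      coef_eq_zero ς n (r := r - 1) fun c hc => h (c + 1) (by push_cast at *; omega),
      coef_eq_zero ς n (r := r - 2) fun c hc => h (c + 1) (by push_cast at *; omega),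
      coef_eq_zero ς (n - 1) (r := r - 2) fun c hc => h (c + 1) (by push_cast at *; omega)]
    simp

/-! ### The recursion for the right factors. -/

/-- The right tensor factor paired with `B_odd^(n - r)` in the coproduct of `B_odd^(n)`. -/
def rightFactor (ς : Qq) (N : ℕ) (n r : ℤ) : U := sumPBW ς (r - n) N (coef ς n r)

theorem rightFactor_of_neg (ς : Qq) (N : ℕ) (n : ℤ) {r : ℤ} (hr : r < 0) :
    rightFactor ς N n r = 0 := by
  have h : ∀ a m, coef ς n r a m = 0 := fun a m => coef_of_lt ς n (by omega)
  simp [rightFactor, sumPBW, h, monomialPBW_zero]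

/-- After the left multiplications every summand carries `K^(r-1-n)`, up to the absorbed `K⁻²`, over
the same index box. The claim is then `coef_recursion` for each pair `(a, m)`. -/
theorem rightFactor_recursion (ς : Qq) (N : ℕ) (n r : ℤ) (hr : r ≤ N) :
    qInt (n + 1) • rightFactor ς (N + 1) (n + 1) r =
      qInt (n + 1 - r) • (((K⁻¹ : Uˣ) : U) * rightFactor ς (N + 1) n r) +
        B ς * rightFactor ς (N + 1) n (r - 1) +
        (if Odd (n - r) then q * ς * qInt (n - r + 2) else 0) •
          (((K⁻¹ : Uˣ) : U) * rightFactor ς (N + 1) n (r - 2)) -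
        (if Odd n then q * ς * qInt n else 0) • rightFactor ς (N + 1) (n - 1) (r - 2) := by
  have e1 : r - (n + 1) = r - 1 - n := by ring
  have e2 : r - n - 1 = r - 1 - n := by ring
  have e3 : r - 2 - n - 1 = r - 1 - n - 2 := by ring
  have e4 : r - 2 - (n - 1) = r - 1 - n := by ring
  simp only [rightFactor, B, add_mul]
  rw [F_mul_sumPBW ς _ N _ fun a m h => coef_of_lt ς n (by omega),
    Echeck_mul_sumPBW ς _ N _ (fun a m h => coef_of_lt ς n (by omega))
      (fun a m h => coef_of_lt ς n (by omega)),
    Kinv_mul_sumPBW, Kinv_mul_sumPBW, e1, e2, e3, e4, sumPBW_sub_two]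
  simp only [smul_sumPBW, sumPBW_add, sumPBW_sub]
  refine sumPBW_congr fun a m => ?_
  rw [coef_recursion, mul_smul_comm, smul_smul, smul_smul, ite_mul,
    zero_mul]

/-! ### The recursion for `BOdd`. -/

/-- The product `∏_{j=1}^k (B² - qς[2j-1]²)`. -/
def prodB (ς : Qq) (k : ℕ) : U :=
  ((List.range k).map fun i =>
    B ς ^ 2 - algebraMap Qq U (q * ς * qInt (2 * (i : ℤ) + 1) ^ 2)).prod

theorem prodB_succ (ς : Qq) (k : ℕ) :
    prodB ς (k + 1) = prodB ς k * (B ς ^ 2 - algebraMap Qq U (q * ς * qInt (2 * k + 1) ^ 2)) := by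
  simp [prodB, List.range_succ]

theorem B_commute_prodB (ς : Qq) (k : ℕ) : Commute (B ς) (prodB ς k) := by
  induction k with
  | zero => simp [prodB]
  | succ k ih =>
    rw [prodB_succ]
    exact ih.mul_right (((Commute.refl _).pow_right 2).sub_right
      (Algebra.commutes' (R := Qq) _ (B ς)).symm)

theorem BOdd_even (ς : Qq) (k : ℕ) :
    BOdd ς (2 * k) = (qFactorial (2 * k))⁻¹ • prodB ς k := by
  rw [BOdd, if_neg (by simp), one_mul, prodB]
  congr 5
  omega

theorem BOdd_odd (ς : Qq) (k : ℕ) :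
    BOdd ς (2 * k + 1) = (qFactorial (2 * k + 1))⁻¹ • (B ς * prodB ς k) := by
  rw [BOdd, if_pos (by simp), prodB]
  congr 6
  omega

/-- For even `n` this is the definition. For `n = 2k + 1` the product contains `B²`, and adding and
subtracting `qς[2k+1]²` completes the next factor of `prodB`. At `n = 0` the truncated `n - 1` has
coefficient zero. -/
theorem B_mul_BOdd (ς : Qq) (n : ℕ) :
    B ς * BOdd ς n = qInt ((n : ℤ) + 1) • BOdd ς (n + 1) +
      (if Odd (n : ℤ) then q * ς * qInt n else 0) • BOdd ς (n - 1) := by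
  rcases Nat.even_or_odd' n with ⟨k, rfl | rfl⟩
  · have h1 := qInt_succ_ne_zero (2 * k)
    have h2 := qFactorial_ne_zero (2 * k)
    rw [if_neg (by simp), zero_smul, add_zero, BOdd_even, BOdd_odd, smul_smul, qFactorial_succ,
      mul_smul_comm]
    congr 1
    field_simp
  · have h1 := qInt_succ_ne_zero (2 * k + 1)
    have h2 := qFactorial_ne_zero (2 * k)
    have h3 := qInt_succ_ne_zero (2 * k)
    have e1 : 2 * k + 1 + 1 = 2 * (k + 1) := by ring
    have e2 : qFactorial (2 * (k + 1)) = qFactorial (2 * k) * qInt (((2 * k : ℕ) : ℤ) + 1) *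
        qInt (((2 * k + 1 : ℕ) : ℤ) + 1) := by
      rw [← e1, qFactorial_succ, qFactorial_succ]
    have e3 : qInt (2 * (k : ℤ) + 1) = qInt (((2 * k : ℕ) : ℤ) + 1) := by push_cast; rfl
    have e4 : qInt ((2 * k + 1 : ℕ) : ℤ) = qInt (((2 * k : ℕ) : ℤ) + 1) := by push_cast; rfl
    rw [if_pos (by simp), Nat.add_sub_cancel, BOdd_odd, e1, BOdd_even, BOdd_even, prodB_succ, e2,
      e3, e4, qFactorial_succ, mul_smul_comm, smul_smul, smul_smul, ← mul_assoc, ← sq, mul_sub,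
      ((B_commute_prodB ς k).pow_left 2).eq, ← Algebra.commutes, ← Algebra.smul_def, smul_sub,
      smul_smul]
    generalize qInt (((2 * k + 1 : ℕ) : ℤ) + 1) = u at *
    generalize qInt (((2 * k : ℕ) : ℤ) + 1) = v at *
    generalize qFactorial (2 * k) = w at *
    have c1 : u * (w * v * u)⁻¹ = (w * v)⁻¹ := by field_simp
    have c2 : (w * v)⁻¹ * (q * ς * v ^ 2) = q * ς * v * w⁻¹ := by field_simp
    rw [c1, c2, sub_add_cancel]

/-! ### The coproduct of `BOdd`. -/

theorem Δ_B (ς : Qq) : Δ (B ς) = B ς ⊗ₜ[Qq] ((K⁻¹ : Uˣ) : U) + (1 : U) ⊗ₜ[Qq] B ς := by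
  have h : Δ ((K⁻¹ : Uˣ) : U) = ((K⁻¹ : Uˣ) : U) ⊗ₜ[Qq] ((K⁻¹ : Uˣ) : U) := Δ_gen Gen.Kinv
  rw [B, map_add, Δ_F, Echeck, map_smul, map_mul, Δ_E, h, add_mul,
    Algebra.TensorProduct.tmul_mul_tmul, Algebra.TensorProduct.tmul_mul_tmul, one_mul,
    Units.mul_inv, smul_add, TensorProduct.add_tmul, TensorProduct.tmul_add,
    TensorProduct.smul_tmul', TensorProduct.tmul_smul]
  abel

theorem rightFactor_zero (ς : Qq) (N : ℕ) : rightFactor ς (N + 1) 0 0 = 1 := by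
  have h : ∀ a m : ℕ, ¬ (a = 0 ∧ m = 0) → monomialPBW ς (0 - 0) a m (coef ς 0 0 a m) = 0 := by
    intro a m ham
    rw [coef_of_lt ς 0 (by omega), monomialPBW_zero]
  rw [rightFactor, sumPBW, Finset.sum_eq_single 0 _ (by simp), Finset.sum_eq_single 0 _ (by simp),
    coef_eq ς 0 (c := 0) (by simp)]
  · simp [coefPoly, hPoly, monomialPBW, divPow_zero]
  · exact fun m _ hm => h 0 m (by simp [hm])
  · exact fun a _ ha => Finset.sum_eq_zero fun m _ => h a m (by simp [ha])

theorem sum_range_add_two_of_zero {M : Type*} [AddCommMonoid M] (f : ℕ → M) (n : ℕ)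
    (h0 : f 0 = 0) (h1 : f 1 = 0) :
    ∑ r ∈ Finset.range (n + 2), f r = ∑ r ∈ Finset.range n, f (r + 2) := by
  rw [Finset.sum_range_succ', Finset.sum_range_succ', h0, zero_add, h1, add_zero, add_zero]

/-- The box size `N` is fixed throughout the induction, so that right factors for different `n` and
`r` are sums over the same indices. -/
theorem Δ_BOdd (ς : Qq) (N n : ℕ) (hn : n ≤ N) :
    Δ (BOdd ς n) =
      ∑ r ∈ Finset.range (n + 1), BOdd ς (n - r) ⊗ₜ[Qq] rightFactor ς (N + 1) n r := by
  induction n using Nat.strong_induction_on with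
  | _ n ih =>
  rcases n with _ | n
  · have h : BOdd ς 0 = 1 := by simp [BOdd, qFactorial]
    simp [h, rightFactor_zero, Algebra.TensorProduct.one_def]
  · have ihn := ih n (by omega) (by omega)
    have hB : qInt ((n : ℤ) + 1) • Δ (BOdd ς (n + 1)) = Δ (B ς) * Δ (BOdd ς n) -
        (if Odd (n : ℤ) then q * ς * qInt n else 0) • Δ (BOdd ς (n - 1)) := by
      rw [← map_mul, B_mul_BOdd, map_add, map_smul, map_smul, add_sub_cancel_right]
    refine smul_right_injective _ (qInt_succ_ne_zero n) ?_
    dsimp only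
    have hrec : ∀ r ∈ Finset.range (n + 2),
        BOdd ς (n + 1 - r) ⊗ₜ[Qq]
          (qInt ((n : ℤ) + 1) • rightFactor ς (N + 1) ((n + 1 : ℕ) : ℤ) r) =
        BOdd ς (n + 1 - r) ⊗ₜ[Qq]
            (qInt ((n : ℤ) + 1 - r) • (((K⁻¹ : Uˣ) : U) * rightFactor ς (N + 1) n r)) +
          BOdd ς (n + 1 - r) ⊗ₜ[Qq] (B ς * rightFactor ς (N + 1) n ((r : ℤ) - 1)) +
          BOdd ς (n + 1 - r) ⊗ₜ[Qq]
            ((if Odd ((n : ℤ) - r) then q * ς * qInt ((n : ℤ) - r + 2) else 0) •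
              (((K⁻¹ : Uˣ) : U) * rightFactor ς (N + 1) n ((r : ℤ) - 2))) -
          BOdd ς (n + 1 - r) ⊗ₜ[Qq]
            ((if Odd (n : ℤ) then q * ς * qInt n else 0) •
              rightFactor ς (N + 1) ((n : ℤ) - 1) ((r : ℤ) - 2)) := by
      intro r hr
      rw [Finset.mem_range] at hr
      push_cast
      rw [rightFactor_recursion ς N n r (by omega), TensorProduct.tmul_sub,
        TensorProduct.tmul_add, TensorProduct.tmul_add]
    rw [hB, ihn, Finset.smul_sum]
    simp only [← TensorProduct.tmul_smul]
    rw [Finset.sum_congr rfl hrec, Finset.sum_sub_distrib, Finset.sum_add_distrib,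
      Finset.sum_add_distrib]
    -- The term `r = n + 1` drops out because `[0] = 0`; elsewhere `n + 1 - r = n - r + 1` holds for
    -- natural subtraction.
    have S1 : ∑ r ∈ Finset.range (n + 2), BOdd ς (n + 1 - r) ⊗ₜ[Qq]
            (qInt ((n : ℤ) + 1 - r) • (((K⁻¹ : Uˣ) : U) * rightFactor ς (N + 1) n r)) =
        ∑ r ∈ Finset.range (n + 1), (qInt (((n - r : ℕ) : ℤ) + 1) • BOdd ς (n - r + 1)) ⊗ₜ[Qq]
            (((K⁻¹ : Uˣ) : U) * rightFactor ς (N + 1) n r) := by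
      rw [Finset.sum_range_succ]
      have h0 : qInt ((n : ℤ) + 1 - ((n + 1 : ℕ) : ℤ)) = 0 := by
        push_cast
        rw [sub_self, qInt_zero]
      rw [h0, zero_smul, TensorProduct.tmul_zero, add_zero]
      refine Finset.sum_congr rfl fun r hr => ?_
      rw [Finset.mem_range] at hr
      have e1 : n + 1 - r = n - r + 1 := by omega
      have e2 : (n : ℤ) + 1 - r = ((n - r : ℕ) : ℤ) + 1 := by omega
      rw [TensorProduct.tmul_smul, TensorProduct.smul_tmul', e1, e2]
    have S2 : ∑ r ∈ Finset.range (n + 2),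
          BOdd ς (n + 1 - r) ⊗ₜ[Qq] (B ς * rightFactor ς (N + 1) n ((r : ℤ) - 1)) =
        ∑ r ∈ Finset.range (n + 1), BOdd ς (n - r) ⊗ₜ[Qq] (B ς * rightFactor ς (N + 1) n r) := by
      rw [Finset.sum_range_succ', rightFactor_of_neg ς _ _ (by simp), mul_zero,
        TensorProduct.tmul_zero, add_zero]
      simp
    -- The index shifts by two: right factors of negative index vanish on the left, and the extra
    -- term `r = n` on the right vanishes because `0` is not odd.
    have S3 : ∑ r ∈ Finset.range (n + 2), BOdd ς (n + 1 - r) ⊗ₜ[Qq]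
            ((if Odd ((n : ℤ) - r) then q * ς * qInt ((n : ℤ) - r + 2) else 0) •
              (((K⁻¹ : Uˣ) : U) * rightFactor ς (N + 1) n ((r : ℤ) - 2))) =
        ∑ r ∈ Finset.range (n + 1),
          ((if Odd ((n - r : ℕ) : ℤ) then q * ς * qInt ((n - r : ℕ) : ℤ) else 0) •
            BOdd ς (n - r - 1)) ⊗ₜ[Qq] (((K⁻¹ : Uˣ) : U) * rightFactor ς (N + 1) n r) := by
      rw [sum_range_add_two_of_zero _ _ (by simp [rightFactor_of_neg])
        (by simp [rightFactor_of_neg]), Finset.sum_range_succ _ n]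
      simp only [Nat.sub_self, Nat.cast_zero, Int.not_odd_zero, if_false, zero_smul,
        TensorProduct.zero_tmul, add_zero]
      refine Finset.sum_congr rfl fun r hr => ?_
      rw [Finset.mem_range] at hr
      have e1 : n + 1 - (r + 2) = n - r - 1 := by omega
      have e2 : (n : ℤ) - ((r + 2 : ℕ) : ℤ) + 2 = ((n - r : ℕ) : ℤ) := by omega
      have e3 : Odd ((n : ℤ) - ((r + 2 : ℕ) : ℤ)) ↔ Odd ((n - r : ℕ) : ℤ) := by
        rw [Int.odd_iff, Int.odd_iff]
        omega
      have e4 : ((r + 2 : ℕ) : ℤ) - 2 = r := by omega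
      rw [TensorProduct.tmul_smul, TensorProduct.smul_tmul', e1, e2, e4]
      simp only [e3]
    have S4 : ∑ r ∈ Finset.range (n + 2), BOdd ς (n + 1 - r) ⊗ₜ[Qq]
            ((if Odd (n : ℤ) then q * ς * qInt n else 0) •
              rightFactor ς (N + 1) ((n : ℤ) - 1) ((r : ℤ) - 2)) =
        (if Odd (n : ℤ) then q * ς * qInt n else 0) • Δ (BOdd ς (n - 1)) := by
      split_ifs with ho
      · have hpos : 1 ≤ n := by
          rcases n with _ | n
          · simp at ho
          · omega
        rw [sum_range_add_two_of_zero _ _ (by simp [rightFactor_of_neg])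
          (by simp [rightFactor_of_neg]), ih (n - 1) (by omega) (by omega), Finset.smul_sum,
          Nat.sub_add_cancel hpos]
        refine Finset.sum_congr rfl fun r hr => ?_
        have e1 : n + 1 - (r + 2) = n - 1 - r := by omega
        have e2 : ((n - 1 : ℕ) : ℤ) = (n : ℤ) - 1 := by omega
        have e4 : ((r + 2 : ℕ) : ℤ) - 2 = r := by omega
        rw [TensorProduct.tmul_smul, e1, e2, e4]
      · simp
    rw [S1, S2, S3, S4, Δ_B, add_mul, Finset.mul_sum, Finset.mul_sum]
    congr 1
    simp only [← Finset.sum_add_distrib]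
    refine Finset.sum_congr rfl fun r _ => ?_
    rw [Algebra.TensorProduct.tmul_mul_tmul, Algebra.TensorProduct.tmul_mul_tmul, one_mul,
      B_mul_BOdd, TensorProduct.add_tmul, add_right_comm]

/-! ### Passage to the stated form of the sums. -/

/-- The support is parametrised injectively by `(c, a) ↦ (a, r - 2c - a)`. -/
theorem sum_range_range_eq_sum_of_support {M : Type*} [AddCommMonoid M] (f : ℕ → ℕ → M)
    {N r : ℕ} (hr : r < N) (hf : ∀ a m, (∀ c, r ≠ a + m + 2 * c) → f a m = 0) :
    ∑ a ∈ Finset.range N, ∑ m ∈ Finset.range N, f a m =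
      ∑ c ∈ Finset.range (r / 2 + 1), ∑ a ∈ Finset.range (r - 2 * c + 1),
        f a (r - 2 * c - a) := by
  rw [← Finset.sum_product', Finset.sum_sigma']
  symm
  refine Finset.sum_of_injOn (fun p => (p.2, r - 2 * p.1 - p.2)) ?_ ?_ ?_ ?_
  · rintro ⟨c, a⟩ h ⟨c', a'⟩ h' he
    simp only [Finset.coe_sigma, Set.mem_sigma_iff, Finset.mem_coe, Finset.mem_range,
      Prod.mk.injEq] at h h' he
    obtain ⟨rfl, he⟩ := he
    obtain rfl : c = c' := by omega
    rfl
  · rintro ⟨c, a⟩ h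
    simp only [Finset.coe_sigma, Set.mem_sigma_iff, Finset.mem_coe, Finset.mem_range,
      Finset.mem_product] at h ⊢
    omega
  · rintro ⟨a, m⟩ - h
    refine hf a m fun c hc => h ⟨⟨c, a⟩, ?_, ?_⟩
    · simp only [Finset.coe_sigma, Set.mem_sigma_iff, Finset.mem_coe, Finset.mem_range]
      omega
    · simp only [Prod.mk.injEq, true_and]
      omega
  · intro i _
    rfl

theorem rightFactor_eq_sum (ς : Qq) {N r : ℕ} (hr : r < N) (n : ℤ) :
    rightFactor ς N n r =
      ∑ c ∈ Finset.range (r / 2 + 1), ∑ a ∈ Finset.range (r - 2 * c + 1),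
        ((-1) ^ c * q ^ ((if Even n then (c : ℤ) else 3 * c) -
            ((r : ℤ) - 2 * c) * ((r : ℤ) - n) + (a : ℤ) * ((r : ℤ) - 2 * c - a)) *
          (q * ς) ^ c) •
          (divPow F a * hBinom (1 - (c : ℤ) + topIndex n r) c * ((K ^ ((r : ℤ) - n) : Uˣ) : U) *
            divPow (Echeck ς) (r - 2 * c - a)) := by
  rw [rightFactor, sumPBW, sum_range_range_eq_sum_of_support _ hr]
  · refine Finset.sum_congr rfl fun c hc => Finset.sum_congr rfl fun a ha => ?_
    rw [Finset.mem_range] at hc ha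
    have hm : ((r - 2 * c - a : ℕ) : ℤ) = (r : ℤ) - 2 * c - a := by omega
    rw [coef_eq ς n (c := c) (by omega), coefPoly, monomialPBW_smul, monomialPBW, aeval_hPoly, hm]
    congr 5
    ring
  · intro a m h
    rw [coef_eq_zero ς n fun c hc => h c (by exact_mod_cast hc), monomialPBW_zero]

theorem floor_ratCast_sub_div_two (r k : ℤ) : ⌊((r : ℚ) - k) / 2⌋ = (r - k) / 2 := by
  have h := Rat.floor_intCast_div_natCast (r - k) 2
  push_cast at h
  exact h

end IDividedPowers

end

open IDividedPowers in
theorem mainTheorem6 (ς : RatFunc ℚ) (hς : ς ≠ 0) (n : ℕ) :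
    (Even n →
      Δ (BOdd ς n) =
        ∑ r ∈ Finset.range (n + 1),
          BOdd ς (n - r) ⊗ₜ[RatFunc ℚ]
            (∑ c ∈ Finset.range (r / 2 + 1), ∑ a ∈ Finset.range (r - 2 * c + 1),
              ((-1) ^ c *
                  q ^ ((c : ℤ) - ((r : ℤ) - 2 * c) * ((r : ℤ) - n)
                    + (a : ℤ) * ((r : ℤ) - 2 * c - a)) *
                  (q * ς) ^ c) •
                (divPow F a * hBinom (1 - (c : ℤ) + ⌊((r : ℚ) - 1) / 2⌋) c *
                  ((K ^ ((r : ℤ) - n) : Uˣ) : U) *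
                  divPow (Echeck ς) (r - 2 * c - a)))) ∧
    (Odd n →
      Δ (BOdd ς n) =
        ∑ r ∈ Finset.range (n + 1),
          BOdd ς (n - r) ⊗ₜ[RatFunc ℚ]
            (∑ c ∈ Finset.range (r / 2 + 1), ∑ a ∈ Finset.range (r - 2 * c + 1),
              ((-1) ^ c *
                  q ^ (3 * (c : ℤ) - ((r : ℤ) - 2 * c) * ((r : ℤ) - n)
                    + (a : ℤ) * ((r : ℤ) - 2 * c - a)) *
                  (q * ς) ^ c) •
                (divPow F a * hBinom (1 - (c : ℤ) + ⌊((r : ℚ) - 2) / 2⌋) c *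
                  ((K ^ ((r : ℤ) - n) : Uˣ) : U) *
                  divPow (Echeck ς) (r - 2 * c - a)))) := by
  -- Integer division by `2` rounds down, so it agrees with the floor also at `r = 0` and `r = 1`,
  -- where a numerator is negative.
  have hfloor : ∀ r : ℕ, ⌊((r : ℚ) - 1) / 2⌋ = ((r : ℤ) - 1) / 2 ∧
      ⌊((r : ℚ) - 2) / 2⌋ = ((r : ℤ) - 2) / 2 := fun r =>
    ⟨mod_cast floor_ratCast_sub_div_two r 1, mod_cast floor_ratCast_sub_div_two r 2⟩
  constructor
  · intro hn
    have hn' : Even (n : ℤ) := mod_cast hn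
    rw [Δ_BOdd ς n n le_rfl]
    refine Finset.sum_congr rfl fun r hr => ?_
    rw [rightFactor_eq_sum ς (Finset.mem_range.1 hr)]
    simp only [topIndex, if_pos hn', (hfloor r).1]
  · intro hn
    have hn' : ¬ Even (n : ℤ) := by
      rw [Int.not_even_iff_odd]
      exact_mod_cast hn
    rw [Δ_BOdd ς n n le_rfl]
    refine Finset.sum_congr rfl fun r hr => ?_
    rw [rightFactor_eq_sum ς (Finset.mem_range.1 hr)]
    simp only [topIndex, if_neg hn', (hfloor r).2]
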